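/- Let $a,h,\lambda,\beta,\sigma>0$, $\eta\ge 0$, $\tau\ge 1$ be real numbers, $K\ge 0$ an integer and $y\in\mathbb{R}^2$. Let $S(c,a)\subset\mathbb{R}^2$ be the closed axis-parallel square with centre $c$ and sides of length $2a$, let $G_0=\{(0,0)\}$ and $G_k=\{(\pm k_1/k,\pm k_2/k): k_1,k_2\in\mathbb{Z}_{\ge 0},\ k_1+k_2=k\}$ for $k\ge 1$, and let $F_k(c,a)=S(c,a)\oplus 2ka\,G_k$ (Minkowski sum). Let $\Phi_0,\dots,\Phi_K$ be independent Poisson point processes, $\Phi_k$ being homogeneous of density $\lambda$ on $F_k(0,a)$. The points of $\Phi_0$ are the transmitters in the room $S(0,a)$, at height $h$ above the receivers, and the points of $\Phi_k$, $k\ge1$, model their $k$-th order wall-reflection images (virtual transmitters). A point $x\in\Phi_k$ is received at $y$ with normalised power $\ell_k(x,y)=\eta^k(|x-y|^2+h^2)^{-\beta}$. If the receiver at $y$ is associated with the point $x$ of $\Phi_k$, its SINR is $\ell_k(x,y)/(I+\sigma^2)$, where $I$ is the sum of the powers received from all the other points of $\Phi_0,\dots,\Phi_K$. The receiver is associated with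 a point of largest received power, and the coverage probability $P_c(\tau,y)$ is the probability that there is such a point and that the resulting SINR exceeds $\tau$. Let $B_{k,y}=F_k(-y,a)\cap\{x:|x|<a_{D,k}\}$ with $a_{D,k}=\left[\eta^{k/\beta}(\tau\sigma^2)^{-1/\beta}-h^2\right]^{1/2}$ (and $B_{k,y}=\emptyset$ if the bracket is not positive), and let $B_y=\bigcup_{k=0}^K B_{k,y}$. Then $$P_c(\tau,y)=\frac{\lambda|B_y|}{2}-\frac{\lambda}{\pi}\int_0^\infty\frac1t\,\mathrm{Im}\left[e^{jt\sigma^2}\,\mathcal{F}_M(jt/\tau,y)\,\mathcal{K}_M(jt,y)\right]\mathrm{d}t ,$$ where the integral converges absolutely, $|B_y|$ is the area of $B_y$, $j$ is the imaginary unit, and $$\mathcal{F}_M(s,y)=\sum_{k=0}^K\int_{B_{k,y}}e^{-s\eta^k(|x|^2+h^2)^{-\beta}}\,\mathrm{d}x,\qquad \mathcal{K}_M(s,y)=\exp\left(-\lambda\sum_{k=0}^K\int_{F_k(-y,a)}\left(1-\exp\left[\frac{s\,\eta^k}{(|z|^2+h^2)^\beta}\right]\right)\mathrm{d}z\right).$$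 -/

import Mathlib

open MeasureTheory ProbabilityTheory
open scoped Pointwise

/-- The horizontal plane `ℝ²`, with its Euclidean norm. -/
abbrev Plane : Type := EuclideanSpace ℝ (Fin 2)

section PointProcesses

variable {Ω E : Type*} [MeasurableSpace Ω]

/-- The number of points of the random set `Φ` in the set `A`. -/
noncomputable def pointCount (Φ : Ω → Set E) (A : Set E) (ω : Ω) : ℕ∞ :=
  (Φ ω ∩ A).encard

/-- The sigma-algebra on `Ω` generated by a point process, that is, by all its counts
`Φ(A)`, `A` a Borel set. -/
@[reducible]
noncomputable def pointProcessSigma [MeasurableSpace E] (Φ : Ω → Set E) : MeasurableSpace Ω :=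
  ⨆ (A : Set E) (_ : MeasurableSet A),
    MeasurableSpace.comap (pointCount Φ A) inferInstance

/-- `Φ` is a (simple) Poisson point process with diffuse intensity measure `Λ`: a random locally
finite set whose counts are Poisson distributed and independent on disjoint sets. -/
structure IsPoissonPointProcess [TopologicalSpace E] [MeasurableSpace E]
    (Φ : Ω → Set E) (Λ : Measure E) (μ : Measure Ω) : Prop where
  locallyFinite : ∀ (ω : Ω) (C : Set E), IsCompact C → (Φ ω ∩ C).Finite
  measurable_count : ∀ A : Set E, MeasurableSet A → Measurable (pointCount Φ A)
  count_law : ∀ A : Set E, MeasurableSet A → Λ A ≠ ⊤ →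
    μ.map (pointCount Φ A) =
      (poissonMeasure (Λ A).toNNReal).map (fun n : ℕ => (n : ℕ∞))
  count_indep : ∀ (n : ℕ) (A : Fin n → Set E), (∀ i, MeasurableSet (A i)) →
    Pairwise (fun i j => Disjoint (A i) (A j)) →
    iIndepFun (fun i => pointCount Φ (A i)) μ

end PointProcesses

/-- The closed square with centre `c` and sides of length `2a`, parallel to the axes. -/
def square (c : Plane) (a : ℝ) : Set Plane := {x | ∀ i, |x i - c i| ≤ a}

/-- The set of the points `(± k₁/k, ± k₂/k)` with natural numbers `k₁ + k₂ = k`;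
it is `{(0, 0)}` for `k = 0`. -/
def imageDirections (k : ℕ) : Set Plane :=
  if k = 0 then {0}
  else {g | ∃ k₁ k₂ : ℕ, k₁ + k₂ = k ∧ |g 0| = (k₁ : ℝ) / k ∧ |g 1| = (k₂ : ℝ) / k}

/-- The region `S(c, a) ⊕ 2ka G_k` (Minkowski sum) of the images of order `k`. -/
def imageRegion (k : ℕ) (c : Plane) (a : ℝ) : Set Plane :=
  square c a + (2 * (k : ℝ) * a) • imageDirections k

/-- The transmitters, real (order `0`) and virtual (order `1, …, K`), as pairs
`(order, location)`. -/
def transmitters {Ω : Type*} {K : ℕ} (Φ : Fin (K + 1) → Ω → Set Plane) (ω : Ω) :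
    Set (Fin (K + 1) × Plane) :=
  {p | p.2 ∈ Φ p.1 ω}

/-- The (normalised) power received at `y` from a transmitter `p = (k, x)`:
`η ^ k * (|x - y|² + h²) ^ (-β)`. -/
noncomputable def rxPower {K : ℕ} (h β η : ℝ) (y : Plane) (p : Fin (K + 1) × Plane) : ℝ :=
  η ^ (p.1 : ℕ) * (‖p.2 - y‖ ^ 2 + h ^ 2) ^ (-β)

/-- The sum of the powers received at `y` from all members of `T` except `p`. -/
noncomputable def interference {K : ℕ} (h β η : ℝ) (y : Plane)
    (T : Set (Fin (K + 1) × Plane)) (p : Fin (K + 1) × Plane) : ℝ :=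
  ∑' q : ↥(T \ {p}), rxPower h β η y q.1

/-- The SINR at `y` if the receiver is associated with the transmitter `p`. -/
noncomputable def sinr {K : ℕ} (h β η σ : ℝ) (y : Plane)
    (T : Set (Fin (K + 1) × Plane)) (p : Fin (K + 1) × Plane) : ℝ :=
  rxPower h β η y p / (interference h β η y T p + σ ^ 2)

/-- The event that the receiver at `y`, associated with the transmitter of largest received
power, has SINR greater than `τ`. (There is no coverage without a transmitter.) -/
def coverageEvent {Ω : Type*} {K : ℕ} (h β η σ τ : ℝ) (Φ : Fin (K + 1) → Ω → Set Plane)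
    (y : Plane) : Set Ω :=
  {ω | ∃ p ∈ transmitters Φ ω,
    (∀ q ∈ transmitters Φ ω, rxPower h β η y q ≤ rxPower h β η y p) ∧
    τ < sinr h β η σ y (transmitters Φ ω) p}

/-- The radius `a_{D,k} = [η ^ (k/β) * (τ σ²) ^ (-1/β) - h²] ^ (1/2)`; it is `0` (so that the open
ball of this radius is empty) if the difference is negative. -/
noncomputable def radiusD (h β η σ τ : ℝ) (k : ℕ) : ℝ :=
  Real.sqrt (η ^ ((k : ℝ) / β) * (τ * σ ^ 2) ^ (-1 / β) - h ^ 2)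

/-- The set `B_{k,y} = F_k(-y, a) ∩ B(0, a_{D,k})`. -/
noncomputable def servingRegion (a h β η σ τ : ℝ) (k : ℕ) (y : Plane) : Set Plane :=
  imageRegion k (-y) a ∩ Metric.ball 0 (radiusD h β η σ τ k)

/-- `F_M(s, y) = ∑_{k ≤ K} ∫_{B_{k,y}} exp(-s η^k (|x|² + h²)^(-β)) dx`. -/
noncomputable def transformF (K : ℕ) (a h β η σ τ : ℝ) (s : ℂ) (y : Plane) : ℂ :=
  ∑ k ∈ Finset.range (K + 1), ∫ x in servingRegion a h β η σ τ k y,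
    Complex.exp (-s * ((η ^ k * (‖x‖ ^ 2 + h ^ 2) ^ (-β) : ℝ) : ℂ))

/-- `K_M(s, y) = exp(-λ ∑_{k ≤ K} ∫_{F_k(-y,a)} (1 - exp(s η^k / (|z|² + h²)^β)) dz)`. -/
noncomputable def transformK (K : ℕ) (lam a h β η : ℝ) (s : ℂ) (y : Plane) : ℂ :=
  Complex.exp (-(lam : ℂ) * ∑ k ∈ Finset.range (K + 1), ∫ z in imageRegion k (-y) a,
    (1 - Complex.exp (s * ((η ^ k / (‖z‖ ^ 2 + h ^ 2) ^ β : ℝ) : ℂ))))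

/-- The integrand of the inversion integral,
`t ↦ (1/t) Im[e^{i t σ²} F_M(i t / τ, y) K_M(i t, y)]`. -/
noncomputable def inversionIntegrand (K : ℕ) (lam a h β η σ τ : ℝ) (y : Plane) (t : ℝ) : ℝ :=
  1 / t * (Complex.exp (Complex.I * t * (σ : ℂ) ^ 2) *
    transformF K a h β η σ τ (Complex.I * t / τ) y *
    transformK K lam a h β η (Complex.I * t) y).im

/-! ### Abel-regularised sine and cosine integrals. -/

section SineIntegrals

open Set Filter Topology

/-! Attach to each transmitter `p` its margin `X p` = (total power) + σ² − (1 + 1/τ)·(power of `p`),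
which is negative exactly when the SINR of `p` exceeds τ. Two transmitters each own part of the
total power, so a negative margin and τ ≥ 1 make `p` strictly stronger than every other transmitter
(`rxPower_lt_of_sinrMargin_neg`). Hence at most one margin is negative, its owner is automatically
the serving transmitter, and the indicator of coverage equals the number of negative margins. A
negative margin also forces power above τσ², so only points of the serving regions need counting.
The coverage probability is therefore the mean number of serving points with negative margin.

Gil-Pelaez inversion, applied to a random finite family instead of one random variable
(`integral_card_filter_neg`), writes this mean as half the mean number of serving points minus 1/π
times the integral of Im φ(t)/t, where φ(t) = E ∑ exp(itX_p). The first mean is λ|B_y|, since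
regions of different orders overlap in null sets. For φ, the total power is common to all margins
and factors out, leaving a sum over points times the exponential of a sum over points; the
exponentially weighted Campbell formula (`IsPoissonPointProcess.campbell`, `campbell_superposition`)
evaluates its mean as λ exp(itσ²) F_M(it/τ) K_M(it).

Inversion needs control at both ends. Near 0, |sin(tx)/t| ≤ |x| and the second moments of Poisson
counts suffice. At infinity φ is square integrable: |K_M| ≤ 1, and each term of F_M is the
characteristic function of an image of planar Lebesgue measure under path loss, which has bounded
density (`map_pathloss_restrict_le`), so a Plancherel-type bound applies
(`integrable_sq_norm_charFun`). Square integrability gives absolute convergence, and it also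
disposes of possible ties X_p = 0: the Abel means include the correction ε∫ exp(−εt) cos(tx) dt,
which tends to 1 at x = 0 and to 0 elsewhere, while its averaged contribution vanishes. -/

theorem integrableOn_exp_neg_mul_Ioi {ε : ℝ} (hε : 0 < ε) :
    IntegrableOn (fun t : ℝ => Real.exp (-(ε * t))) (Ioi 0) := by
  simpa [neg_mul] using integrableOn_exp_mul_Ioi (a := -ε) (by linarith) 0

theorem integral_exp_neg_mul_mul_cos {ε : ℝ} (hε : 0 < ε) (x : ℝ) :
    ∫ t in Ioi (0 : ℝ), Real.exp (-(ε * t)) * Real.cos (t * x) = ε / (ε ^ 2 + x ^ 2) := by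
  have h := integral_exp_mul_complex_Ioi (a := -ε + x * Complex.I) (by simpa using hε) 0
  have hi : IntegrableOn (fun t : ℝ => Complex.exp ((-ε + x * Complex.I) * t)) (Ioi 0) :=
    integrableOn_exp_mul_complex_Ioi (by simpa using hε) 0
  have h2 := integral_re (𝕜 := ℂ) hi
  rw [h] at h2
  have h3 : ∀ t : ℝ, RCLike.re (Complex.exp ((-ε + x * Complex.I) * t))
      = Real.exp (-(ε * t)) * Real.cos (t * x) := by
    intro t
    simp [Complex.exp_re, mul_comm]
  simp only [h3] at h2
  rw [h2]
  simp only [Complex.ofReal_zero, mul_zero, Complex.exp_zero, RCLike.re_eq_complex_re,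
    Complex.div_re, Complex.normSq_apply]
  simp
  ring_nf

theorem abs_sin_mul_div_le (t x : ℝ) : |Real.sin (t * x) / t| ≤ |x| := by
  rcases eq_or_ne t 0 with rfl | ht
  · simp
  · rw [abs_div, div_le_iff₀ (abs_pos.mpr ht), mul_comm |x|, ← abs_mul]
    exact Real.abs_sin_le_abs

/-- Differentiation in x under the integral turns the left side into the Laplace transform of the
cosine, which is also the derivative of the right side; both sides vanish at x = 0. -/
theorem integral_exp_neg_mul_mul_sin_div {ε : ℝ} (hε : 0 < ε) (x : ℝ) :
    ∫ t in Ioi (0 : ℝ), Real.exp (-(ε * t)) * (Real.sin (t * x) / t) = Real.arctan (x / ε) := by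
  have hint := integrableOn_exp_neg_mul_Ioi hε
  have hmeas : ∀ x : ℝ, AEStronglyMeasurable
      (fun t : ℝ => Real.exp (-(ε * t)) * (Real.sin (t * x) / t)) (volume.restrict (Ioi 0)) := by
    intro x
    exact Measurable.aestronglyMeasurable (by fun_prop)
  have hderiv : ∀ x : ℝ, HasDerivAt
      (fun x : ℝ => ∫ t in Ioi (0 : ℝ), Real.exp (-(ε * t)) * (Real.sin (t * x) / t))
      (ε / (ε ^ 2 + x ^ 2)) x := by
    intro x
    rw [← integral_exp_neg_mul_mul_cos hε x]
    refine (hasDerivAt_integral_of_dominated_loc_of_deriv_le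
      (F' := fun x t => Real.exp (-(ε * t)) * Real.cos (t * x))
      (bound := fun t => Real.exp (-(ε * t))) (s := univ) Filter.univ_mem
      (Eventually.of_forall hmeas) ?_ ?_ ?_ hint ?_).2
    · refine Integrable.mono' (hint.mul_const |x|) (hmeas x) (Eventually.of_forall fun t => ?_)
      rw [Real.norm_eq_abs, abs_mul, abs_of_pos (Real.exp_pos _)]
      exact mul_le_mul_of_nonneg_left (abs_sin_mul_div_le t x) (Real.exp_pos _).le
    · exact Continuous.aestronglyMeasurable (by fun_prop)
    · refine Eventually.of_forall fun t y _ => ?_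
      rw [Real.norm_eq_abs, abs_mul, abs_of_pos (Real.exp_pos _)]
      exact mul_le_of_le_one_right (Real.exp_pos _).le (Real.abs_cos_le_one _)
    · refine (ae_restrict_mem measurableSet_Ioi).mono fun t ht y _ => ?_
      have ht : t ≠ 0 := ne_of_gt ht
      have h1 : HasDerivAt (fun y : ℝ => Real.sin (t * y)) (Real.cos (t * y) * t) y := by
        have := ((hasDerivAt_id' y).const_mul t).sin
        rwa [mul_one] at this
      have := (h1.div_const t).const_mul (Real.exp (-(ε * t)))
      rwa [mul_div_assoc, div_self ht, mul_one] at this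
  have hat : ∀ x : ℝ, HasDerivAt (fun x : ℝ => Real.arctan (x / ε)) (ε / (ε ^ 2 + x ^ 2)) x := by
    intro x
    have := ((hasDerivAt_id' x).div_const ε).arctan
    convert this using 1
    field_simp
  have hdiff : ∀ x, HasDerivAt (fun x : ℝ =>
      (∫ t in Ioi (0 : ℝ), Real.exp (-(ε * t)) * (Real.sin (t * x) / t))
        - Real.arctan (x / ε)) 0 x := fun x =>
    ((hderiv x).sub (hat x)).congr_deriv (sub_self _)
  have := is_const_of_deriv_eq_zero (fun x => (hdiff x).differentiableAt)
    (fun x => (hdiff x).deriv) x 0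
  simp at this
  linarith

/-- The arctangent alone would give sign x, with value 0 at x = 0. The second summand is 1 there and
tends to 0 elsewhere, so the limit encodes the strict condition x < 0 at every point. The parameter
is ε = δ², which keeps later estimates free of square roots. -/
theorem tendsto_arctan_div_sq_add (x : ℝ) :
    Tendsto (fun δ : ℝ => 2 / Real.pi * Real.arctan (x / δ ^ 2)
        + δ ^ 2 * (δ ^ 2 / ((δ ^ 2) ^ 2 + x ^ 2))) (𝓝[>] 0)
      (𝓝 (1 - 2 * (if x < 0 then 1 else 0))) := by
  have hδ : Tendsto (fun δ : ℝ => δ ^ 2) (𝓝[>] 0) (𝓝[>] 0) := by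
    refine tendsto_nhdsWithin_iff.mpr ⟨?_, ?_⟩
    · have : Tendsto (fun δ : ℝ => δ ^ 2) (𝓝 0) (𝓝 (0 ^ 2)) := (continuous_pow 2).tendsto 0
      simpa using this.mono_left nhdsWithin_le_nhds
    · filter_upwards [self_mem_nhdsWithin] with δ (h : 0 < δ)
      exact pow_pos h 2
  suffices h : Tendsto (fun ε : ℝ => 2 / Real.pi * Real.arctan (x / ε)
        + ε * (ε / (ε ^ 2 + x ^ 2))) (𝓝[>] 0)
      (𝓝 (1 - 2 * (if x < 0 then 1 else 0))) from h.comp hδ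
  have hinv : Tendsto (fun ε : ℝ => ε⁻¹) (𝓝[>] 0) atTop := tendsto_inv_nhdsGT_zero
  have hsecond : x ≠ 0 → Tendsto (fun ε : ℝ => ε * (ε / (ε ^ 2 + x ^ 2))) (𝓝[>] 0) (𝓝 0) := by
    intro hx
    have : ContinuousAt (fun ε : ℝ => ε * (ε / (ε ^ 2 + x ^ 2))) 0 := by
      refine continuousAt_id.mul (continuousAt_id.div (by fun_prop) ?_)
      simpa using hx
    simpa using this.tendsto.mono_left nhdsWithin_le_nhds
  have hpi := Real.pi_pos.ne'
  rcases lt_trichotomy x 0 with hx | hx | hx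
  · have h1 : Tendsto (fun ε : ℝ => Real.arctan (x / ε)) (𝓝[>] 0) (𝓝 (-(Real.pi / 2))) :=
      (Real.tendsto_arctan_atBot.mono_right nhdsWithin_le_nhds).comp
        (hinv.const_mul_atTop_of_neg hx)
    have := (h1.const_mul (2 / Real.pi)).add (hsecond hx.ne)
    convert this using 2
    rw [if_pos hx]; field_simp; norm_num
  · subst hx
    refine Tendsto.congr' ?_ tendsto_const_nhds
    filter_upwards [self_mem_nhdsWithin] with ε (h : 0 < ε)
    simp
    field_simp
  · have h1 : Tendsto (fun ε : ℝ => Real.arctan (x / ε)) (𝓝[>] 0) (𝓝 (Real.pi / 2)) :=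
      (Real.tendsto_arctan_atTop.mono_right nhdsWithin_le_nhds).comp
        (hinv.const_mul_atTop hx)
    have := (h1.const_mul (2 / Real.pi)).add (hsecond hx.ne')
    convert this using 2
    rw [if_neg hx.not_gt]; field_simp; norm_num

theorem abs_arctan_div_add_le (x ε : ℝ) :
    |2 / Real.pi * Real.arctan (x / ε) + ε * (ε / (ε ^ 2 + x ^ 2))| ≤ 2 := by
  have h1 : |2 / Real.pi * Real.arctan (x / ε)| ≤ 1 := by
    rw [abs_mul, abs_of_pos (by positivity : 0 < 2 / Real.pi), div_mul_eq_mul_div,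
      div_le_one Real.pi_pos]
    have : |Real.arctan (x / ε)| ≤ Real.pi / 2 :=
      abs_le.mpr ⟨(Real.neg_pi_div_two_lt_arctan _).le, (Real.arctan_lt_pi_div_two _).le⟩
    linarith
  have h2 : |ε * (ε / (ε ^ 2 + x ^ 2))| ≤ 1 := by
    rw [← mul_div_assoc, abs_of_nonneg (by rw [← sq]; positivity)]
    exact div_le_one_of_le₀ (by nlinarith [sq_nonneg x]) (by positivity)
  exact (abs_add_le _ _).trans (by linarith)

end SineIntegrals

/-! ### Gil-Pelaez inversion for random finite families. -/

section Inversion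

open Set Filter Topology

variable {Ω ι : Type*}

/-- The exponential sum `t ↦ ∑ exp(i t x)` over a finite family of reals. -/
noncomputable def expSum (P : Finset ι) (x : ι → ℝ) (t : ℝ) : ℂ :=
  ∑ p ∈ P, Complex.exp (Complex.I * t * x p)

theorem expSum_term (t x : ℝ) :
    Complex.exp (Complex.I * t * x) = (Real.cos (t * x) : ℂ) + (Real.sin (t * x) : ℂ) * Complex.I := by
  have : Complex.I * t * x = ((t * x : ℝ) : ℂ) * Complex.I := by push_cast; ring
  rw [this, Complex.exp_mul_I, ← Complex.ofReal_cos, ← Complex.ofReal_sin]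

theorem expSum_re (P : Finset ι) (x : ι → ℝ) (t : ℝ) :
    (expSum P x t).re = ∑ p ∈ P, Real.cos (t * x p) := by
  simp only [expSum, expSum_term, Complex.re_sum]
  refine Finset.sum_congr rfl fun p _ => ?_
  rw [Complex.add_re, Complex.re_ofReal_mul, Complex.I_re, mul_zero, add_zero, Complex.ofReal_re]

theorem expSum_im (P : Finset ι) (x : ι → ℝ) (t : ℝ) :
    (expSum P x t).im = ∑ p ∈ P, Real.sin (t * x p) := by
  simp only [expSum, expSum_term, Complex.im_sum]
  refine Finset.sum_congr rfl fun p _ => ?_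
  rw [Complex.add_im, Complex.im_ofReal_mul, Complex.I_im, mul_one, Complex.ofReal_im, zero_add]

theorem norm_expSum_le (P : Finset ι) (x : ι → ℝ) (t : ℝ) : ‖expSum P x t‖ ≤ P.card := by
  refine (norm_sum_le _ _).trans ?_
  have : ∀ p, ‖Complex.exp (Complex.I * t * x p)‖ = 1 := fun p => by
    have : Complex.I * t * x p = ((t * x p : ℝ) : ℂ) * Complex.I := by push_cast; ring
    rw [this, Complex.norm_exp_ofReal_mul_I]
  simp [this]

theorem continuous_expSum (P : Finset ι) (x : ι → ℝ) : Continuous (expSum P x) := by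
  unfold expSum; fun_prop

theorem abs_inv_mul_expSum_im_le (P : Finset ι) (x : ι → ℝ) (t : ℝ) :
    |1 / t * (expSum P x t).im| ≤ ∑ p ∈ P, |x p| := by
  rw [expSum_im, Finset.mul_sum]
  refine (Finset.abs_sum_le_sum_abs _ _).trans (Finset.sum_le_sum fun p _ => ?_)
  rw [one_div_mul_eq_div]
  exact abs_sin_mul_div_le t (x p)

theorem integral_exp_neg_mul_mul_expSum {ε : ℝ} (hε : 0 < ε) (P : Finset ι) (x : ι → ℝ) :
    ∫ t in Ioi (0 : ℝ), Real.exp (-(ε * t)) *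
      (2 / Real.pi * (1 / t * (expSum P x t).im) + ε * (expSum P x t).re)
      = ∑ p ∈ P, (2 / Real.pi * Real.arctan (x p / ε) + ε * (ε / (ε ^ 2 + x p ^ 2))) := by
  have hint := integrableOn_exp_neg_mul_Ioi hε
  have h1 : ∀ y : ℝ, IntegrableOn (fun t : ℝ => Real.exp (-(ε * t)) * (Real.sin (t * y) / t))
      (Ioi 0) := fun y => by
    refine Integrable.mono' (hint.mul_const |y|) (Measurable.aestronglyMeasurable (by fun_prop))
      (Eventually.of_forall fun t => ?_)
    rw [Real.norm_eq_abs, abs_mul, abs_of_pos (Real.exp_pos _)]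
    exact mul_le_mul_of_nonneg_left (abs_sin_mul_div_le t y) (Real.exp_pos _).le
  have h2 : ∀ y : ℝ, IntegrableOn (fun t : ℝ => Real.exp (-(ε * t)) * Real.cos (t * y))
      (Ioi 0) := fun y => by
    refine Integrable.mono' hint (Measurable.aestronglyMeasurable (by fun_prop))
      (Eventually.of_forall fun t => ?_)
    rw [Real.norm_eq_abs, abs_mul, abs_of_pos (Real.exp_pos _)]
    exact mul_le_of_le_one_right (Real.exp_pos _).le (Real.abs_cos_le_one _)
  have heq : ∀ t : ℝ, Real.exp (-(ε * t)) *
      (2 / Real.pi * (1 / t * (expSum P x t).im) + ε * (expSum P x t).re)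
      = ∑ p ∈ P, (2 / Real.pi * (Real.exp (-(ε * t)) * (Real.sin (t * x p) / t))
        + ε * (Real.exp (-(ε * t)) * Real.cos (t * x p))) := by
    intro t
    rw [expSum_im, expSum_re, Finset.sum_add_distrib, ← Finset.mul_sum, ← Finset.mul_sum,
      ← Finset.mul_sum, ← Finset.mul_sum, ← Finset.sum_div]
    ring
  simp only [heq]
  have hi : ∀ p ∈ P, IntegrableOn (fun t : ℝ =>
      2 / Real.pi * (Real.exp (-(ε * t)) * (Real.sin (t * x p) / t))
        + ε * (Real.exp (-(ε * t)) * Real.cos (t * x p))) (Ioi 0) := fun p _ =>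
    ((h1 (x p)).const_mul _).add ((h2 (x p)).const_mul _)
  rw [integral_finsetSum _ hi]
  refine Finset.sum_congr rfl fun p _ => ?_
  rw [integral_add ((h1 (x p)).const_mul _) ((h2 (x p)).const_mul _), integral_const_mul,
    integral_const_mul, integral_exp_neg_mul_mul_sin_div hε, integral_exp_neg_mul_mul_cos hε]

variable [MeasurableSpace Ω] {μ : Measure Ω}
  {P : Ω → Finset ι} {X : Ω → ι → ℝ}

theorem measurable_uncurry_expSum (hmeas : ∀ t, Measurable fun ω => expSum (P ω) (X ω) t) :
    Measurable (Function.uncurry fun (t : ℝ) (ω : Ω) => expSum (P ω) (X ω) t) :=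
  measurable_uncurry_of_continuous_of_measurable (fun ω => continuous_expSum (P ω) (X ω)) hmeas

theorem measurable_integral_expSum [SFinite μ] (hmeas : ∀ t, Measurable fun ω => expSum (P ω) (X ω) t) :
    Measurable fun t => ∫ ω, expSum (P ω) (X ω) t ∂μ :=
  ((measurable_uncurry_expSum hmeas).stronglyMeasurable.integral_prod_right').measurable

theorem integrable_expSum (hmeas : ∀ t, Measurable fun ω => expSum (P ω) (X ω) t)
    (hcard : Integrable (fun ω => ((P ω).card : ℝ)) μ) (t : ℝ) :
    Integrable (fun ω => expSum (P ω) (X ω) t) μ :=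
  hcard.mono' (hmeas t).aestronglyMeasurable (Eventually.of_forall fun _ => norm_expSum_le _ _ _)

theorem integral_expSum_im (hmeas : ∀ t, Measurable fun ω => expSum (P ω) (X ω) t)
    (hcard : Integrable (fun ω => ((P ω).card : ℝ)) μ) (t : ℝ) :
    ∫ ω, (expSum (P ω) (X ω) t).im ∂μ = (∫ ω, expSum (P ω) (X ω) t ∂μ).im :=
  integral_im (𝕜 := ℂ) (integrable_expSum hmeas hcard t)

theorem integral_expSum_re (hmeas : ∀ t, Measurable fun ω => expSum (P ω) (X ω) t)
    (hcard : Integrable (fun ω => ((P ω).card : ℝ)) μ) (t : ℝ) :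
    ∫ ω, (expSum (P ω) (X ω) t).re ∂μ = (∫ ω, expSum (P ω) (X ω) t ∂μ).re :=
  integral_re (𝕜 := ℂ) (integrable_expSum hmeas hcard t)

/-- On (0, 1] the integrand is bounded by the mean of `W`; beyond 1, the inequality |φ|/t ≤ 1/t² +
|φ|² reduces the claim to square integrability. -/
theorem integrableOn_inv_mul_im_integral_expSum [SFinite μ]
    (hmeas : ∀ t, Measurable fun ω => expSum (P ω) (X ω) t)
    (hcard : Integrable (fun ω => ((P ω).card : ℝ)) μ)
    {W : Ω → ℝ} (hW : Integrable W μ) (hX : ∀ ω, ∑ p ∈ P ω, |X ω p| ≤ W ω)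
    (hL2 : IntegrableOn (fun t => ‖∫ ω, expSum (P ω) (X ω) t ∂μ‖ ^ 2) (Ioi 0)) :
    IntegrableOn (fun t => 1 / t * (∫ ω, expSum (P ω) (X ω) t ∂μ).im) (Ioi 0) := by
  have hm : Measurable (fun t : ℝ => 1 / t * (∫ ω, expSum (P ω) (X ω) t ∂μ).im) :=
    (measurable_const.div measurable_id).mul
      (Complex.measurable_im.comp (measurable_integral_expSum hmeas))
  rw [← Ioc_union_Ioi_eq_Ioi (zero_le_one' ℝ)]
  refine IntegrableOn.union ?_ ?_
  · refine Integrable.mono' (g := fun _ => ∫ ω, W ω ∂μ) (integrable_const _)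
      hm.aestronglyMeasurable (Eventually.of_forall fun t => ?_)
    rw [← integral_expSum_im hmeas hcard, ← integral_const_mul]
    refine (norm_integral_le_integral_norm _).trans ?_
    refine integral_mono_of_nonneg (Eventually.of_forall fun _ => norm_nonneg _) hW
      (Eventually.of_forall fun ω => ?_)
    exact (abs_inv_mul_expSum_im_le _ _ _).trans (hX ω)
  · have h1 : IntegrableOn (fun t : ℝ => t ^ (-2 : ℝ)) (Ioi 1) :=
      integrableOn_Ioi_rpow_of_lt (by norm_num) one_pos
    have h2 := hL2.mono_set (Ioi_subset_Ioi (zero_le_one' ℝ))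
    refine Integrable.mono' (h1.add h2) hm.aestronglyMeasurable ?_
    refine (ae_restrict_mem measurableSet_Ioi).mono fun t (ht : 1 < t) => ?_
    have ht0 : 0 < t := by linarith
    have h3 : t ^ (-2 : ℝ) = (1 / t) ^ 2 := by
      rw [Real.rpow_neg ht0.le]; norm_num
    have h4 := Complex.abs_im_le_norm (∫ ω, expSum (P ω) (X ω) t ∂μ)
    rw [Pi.add_apply, h3, Real.norm_eq_abs, abs_mul, abs_of_pos (by positivity : 0 < 1 / t)]
    have : 0 < 1 / t := by positivity
    nlinarith [sq_nonneg (1 / t - ‖∫ ω, expSum (P ω) (X ω) t ∂μ‖),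
      mul_le_mul_of_nonneg_left h4 this.le, sq_nonneg (1 / t),
      sq_nonneg ‖∫ ω, expSum (P ω) (X ω) t ∂μ‖]

/-- Fubini, legitimate because the damping exp(−εt) multiplies a bound that is integrable in ω and
independent of t. -/
theorem integral_sum_arctan_div [SFinite μ]
    (hmeas : ∀ t, Measurable fun ω => expSum (P ω) (X ω) t)
    (hcard : Integrable (fun ω => ((P ω).card : ℝ)) μ)
    {W : Ω → ℝ} (hW : Integrable W μ) (hX : ∀ ω, ∑ p ∈ P ω, |X ω p| ≤ W ω) {ε : ℝ} (hε : 0 < ε) :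
    Integrable (fun ω => ∑ p ∈ P ω,
      (2 / Real.pi * Real.arctan (X ω p / ε) + ε * (ε / (ε ^ 2 + X ω p ^ 2)))) μ ∧
    ∫ ω, ∑ p ∈ P ω, (2 / Real.pi * Real.arctan (X ω p / ε) + ε * (ε / (ε ^ 2 + X ω p ^ 2))) ∂μ
      = ∫ t in Ioi (0 : ℝ), Real.exp (-(ε * t)) *
        (2 / Real.pi * (1 / t * (∫ ω, expSum (P ω) (X ω) t ∂μ).im)
          + ε * (∫ ω, expSum (P ω) (X ω) t ∂μ).re) := by
  have hint := integrableOn_exp_neg_mul_Ioi hε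
  have hu := (measurable_uncurry_expSum hmeas).comp measurable_swap
  have hG : Integrable (Function.uncurry fun (ω : Ω) (t : ℝ) => Real.exp (-(ε * t)) *
      (2 / Real.pi * (1 / t * (expSum (P ω) (X ω) t).im) + ε * (expSum (P ω) (X ω) t).re))
      (μ.prod (volume.restrict (Ioi 0))) := by
    have hb : Integrable (fun z : Ω × ℝ => (2 / Real.pi * W z.1 + ε * (P z.1).card)
        * Real.exp (-(ε * z.2))) (μ.prod (volume.restrict (Ioi 0))) :=
      ((hW.const_mul _).add (hcard.const_mul ε)).mul_prod hint
    refine hb.mono' ?_ (Eventually.of_forall fun z => ?_)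
    · refine Measurable.aestronglyMeasurable ?_
      refine Measurable.mul (by fun_prop) (Measurable.add ?_ ?_)
      · exact ((measurable_const.div measurable_snd).mul
          (Complex.measurable_im.comp hu)).const_mul _
      · exact (Complex.measurable_re.comp hu).const_mul _
    · rw [Function.uncurry, norm_mul, Real.norm_eq_abs, abs_of_pos (Real.exp_pos _), mul_comm]
      refine mul_le_mul_of_nonneg_right ?_ (Real.exp_pos _).le
      refine (norm_add_le _ _).trans (add_le_add ?_ ?_)
      · rw [norm_mul, Real.norm_eq_abs, abs_of_pos (by positivity : 0 < 2 / Real.pi)]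
        exact mul_le_mul_of_nonneg_left ((abs_inv_mul_expSum_im_le _ _ _).trans (hX z.1))
          (by positivity)
      · rw [norm_mul, Real.norm_eq_abs, abs_of_pos hε]
        exact mul_le_mul_of_nonneg_left
          ((Complex.abs_re_le_norm _).trans (norm_expSum_le _ _ _)) hε.le
  have h1 := hG.integral_prod_left
  simp only [Function.uncurry, integral_exp_neg_mul_mul_expSum hε] at h1
  refine ⟨h1, ?_⟩
  have h2 := integral_integral_swap hG
  simp only [integral_exp_neg_mul_mul_expSum hε] at h2
  rw [h2]
  refine integral_congr_ae (Eventually.of_forall fun t => ?_)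
  have hi := integrable_expSum (μ := μ) hmeas hcard t
  have him : Integrable (fun ω => (expSum (P ω) (X ω) t).im) μ := hi.im
  have hre : Integrable (fun ω => (expSum (P ω) (X ω) t).re) μ := hi.re
  simp only
  rw [integral_const_mul, integral_add ((him.const_mul _).const_mul _) (hre.const_mul _),
    integral_const_mul, integral_const_mul, integral_const_mul, integral_expSum_im hmeas hcard,
    integral_expSum_re hmeas hcard]

/-- Gil-Pelaez inversion for the mean number of negative members of a random finite family. -/
theorem integral_card_filter_neg [SFinite μ]
    (hmeas : ∀ t, Measurable fun ω => expSum (P ω) (X ω) t)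
    (hcard : Integrable (fun ω => ((P ω).card : ℝ)) μ)
    {W : Ω → ℝ} (hW : Integrable W μ) (hX : ∀ ω, ∑ p ∈ P ω, |X ω p| ≤ W ω)
    (hL2 : IntegrableOn (fun t => ‖∫ ω, expSum (P ω) (X ω) t ∂μ‖ ^ 2) (Ioi 0)) :
    ∫ ω, (((P ω).filter (fun p => X ω p < 0)).card : ℝ) ∂μ
      = (∫ ω, ((P ω).card : ℝ) ∂μ) / 2
        - 1 / Real.pi * ∫ t in Ioi (0 : ℝ), 1 / t * (∫ ω, expSum (P ω) (X ω) t ∂μ).im := by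
  set φ : ℝ → ℂ := fun t => ∫ ω, expSum (P ω) (X ω) t ∂μ with hφ
  have hφm : Measurable φ := measurable_integral_expSum hmeas
  have hint : IntegrableOn (fun t => 1 / t * (φ t).im) (Ioi 0) :=
    integrableOn_inv_mul_im_integral_expSum hmeas hcard hW hX hL2
  have hpos : ∀ᶠ δ : ℝ in 𝓝[>] 0, 0 < δ := self_mem_nhdsWithin
  have hD : ∀ ω, ((P ω).card : ℝ) - 2 * (((P ω).filter (fun p => X ω p < 0)).card : ℝ)
      = ∑ p ∈ P ω, (1 - 2 * (if X ω p < 0 then 1 else 0)) := by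
    intro ω
    rw [Finset.sum_sub_distrib, ← Finset.mul_sum, Finset.sum_boole]
    simp
  have hlim : ∀ ω, Tendsto (fun δ : ℝ => ∑ p ∈ P ω, (2 / Real.pi * Real.arctan (X ω p / δ ^ 2)
      + δ ^ 2 * (δ ^ 2 / ((δ ^ 2) ^ 2 + X ω p ^ 2)))) (𝓝[>] 0)
      (𝓝 (((P ω).card : ℝ) - 2 * (((P ω).filter (fun p => X ω p < 0)).card : ℝ))) := by
    intro ω
    rw [hD]
    exact tendsto_finsetSum _ fun p _ => tendsto_arctan_div_sq_add (X ω p)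
  have hbd : ∀ (δ : ℝ) ω, ‖∑ p ∈ P ω, (2 / Real.pi * Real.arctan (X ω p / δ ^ 2)
      + δ ^ 2 * (δ ^ 2 / ((δ ^ 2) ^ 2 + X ω p ^ 2)))‖ ≤ (P ω).card * 2 := by
    intro δ ω
    refine (norm_sum_le _ _).trans ?_
    refine (Finset.sum_le_sum fun p _ => abs_arctan_div_add_le (X ω p) (δ ^ 2)).trans ?_
    simp
  have hmδ : ∀ δ : ℝ, AEStronglyMeasurable (fun ω =>
      ∑ p ∈ P ω, (2 / Real.pi * Real.arctan (X ω p / δ ^ 2)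
      + δ ^ 2 * (δ ^ 2 / ((δ ^ 2) ^ 2 + X ω p ^ 2)))) μ :=
    fun δ => by
      -- Measurability is asked for every δ. At δ = 0 the convention x / 0 = 0 makes the sum
      -- identically zero.
      rcases eq_or_ne δ 0 with rfl | hδ
      · simpa using aestronglyMeasurable_const
      · exact (integral_sum_arctan_div hmeas hcard hW hX
          (by positivity : 0 < δ ^ 2)).1.aestronglyMeasurable
  have hL := tendsto_integral_filter_of_dominated_convergence (fun ω => ((P ω).card : ℝ) * 2)
    (Eventually.of_forall hmδ)
    (Eventually.of_forall fun δ => Eventually.of_forall (hbd δ)) (hcard.mul_const 2)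
    (Eventually.of_forall hlim)
  have hR1 : Tendsto (fun δ : ℝ => ∫ t in Ioi (0 : ℝ), Real.exp (-(δ ^ 2 * t)) *
      (2 / Real.pi * (1 / t * (φ t).im))) (𝓝[>] 0)
      (𝓝 (∫ t in Ioi (0 : ℝ), 2 / Real.pi * (1 / t * (φ t).im))) := by
    refine tendsto_integral_filter_of_dominated_convergence
      (fun t => ‖2 / Real.pi * (1 / t * (φ t).im)‖) ?_ ?_ (hint.const_mul _).norm ?_
    · refine Eventually.of_forall fun δ => ?_
      exact ((by fun_prop : Measurable fun t : ℝ => Real.exp (-(δ ^ 2 * t))).aestronglyMeasurable).mul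
        (hint.const_mul _).aestronglyMeasurable
    · refine Eventually.of_forall fun δ => (ae_restrict_mem measurableSet_Ioi).mono
        fun t (ht : 0 < t) => ?_
      rw [norm_mul, Real.norm_eq_abs (Real.exp _), abs_of_pos (Real.exp_pos _)]
      exact mul_le_of_le_one_left (norm_nonneg _) (Real.exp_le_one_iff.mpr (by
        have := mul_nonneg (sq_nonneg δ) ht.le; linarith))
    · refine Eventually.of_forall fun t => ?_
      have : Continuous fun δ : ℝ => Real.exp (-(δ ^ 2 * t)) * (2 / Real.pi * (1 / t * (φ t).im)) := by
        fun_prop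
      have := this.tendsto 0
      simp only [ne_eq, OfNat.ofNat_ne_zero, not_false_eq_true, zero_pow, zero_mul, neg_zero,
        Real.exp_zero, one_mul] at this
      simpa using this.mono_left nhdsWithin_le_nhds
  -- The factor δ² is split as δ · δ: one δ goes with the exponential into a product with |φ|, to
  -- which the arithmetic-geometric inequality applies, and the other makes both resulting terms
  -- small after integration.
  have hre_bd : ∀ (δ : ℝ), 0 < δ → ∀ t : ℝ, ‖Real.exp (-(δ ^ 2 * t)) * (δ ^ 2 * (φ t).re)‖
      ≤ δ ^ 3 * Real.exp (-(2 * δ ^ 2 * t)) + δ * ‖φ t‖ ^ 2 := by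
    intro δ hδ t
    have h1 : Real.exp (-(2 * δ ^ 2 * t)) = Real.exp (-(δ ^ 2 * t)) ^ 2 := by
      rw [← Real.exp_nat_mul]; ring_nf
    rw [h1, norm_mul, norm_mul, Real.norm_eq_abs, abs_of_pos (Real.exp_pos _), Real.norm_eq_abs,
      abs_of_pos (pow_pos hδ 2), Real.norm_eq_abs]
    have h2 := Complex.abs_re_le_norm (φ t)
    set E := Real.exp (-(δ ^ 2 * t))
    have hE : 0 < E := Real.exp_pos _
    calc E * (δ ^ 2 * |(φ t).re|) ≤ E * (δ ^ 2 * ‖φ t‖) := by gcongr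
      _ = δ * (E * δ * ‖φ t‖) := by ring
      _ ≤ δ * ((E * δ) ^ 2 + ‖φ t‖ ^ 2) := by
          refine mul_le_mul_of_nonneg_left ?_ hδ.le
          nlinarith [sq_nonneg (E * δ - ‖φ t‖), sq_nonneg (E * δ), sq_nonneg ‖φ t‖]
      _ = δ ^ 3 * E ^ 2 + δ * ‖φ t‖ ^ 2 := by ring
  have hbint : ∀ δ : ℝ, 0 < δ → IntegrableOn (fun t : ℝ =>
      δ ^ 3 * Real.exp (-(2 * δ ^ 2 * t)) + δ * ‖φ t‖ ^ 2) (Ioi 0) := fun δ hδ =>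
    ((integrableOn_exp_neg_mul_Ioi (by positivity : 0 < 2 * δ ^ 2)).const_mul _).add
      (hL2.const_mul _)
  have hreint : ∀ δ : ℝ, 0 < δ → IntegrableOn (fun t : ℝ =>
      Real.exp (-(δ ^ 2 * t)) * (δ ^ 2 * (φ t).re)) (Ioi 0) := fun δ hδ =>
    (hbint δ hδ).mono' (Measurable.aestronglyMeasurable (Measurable.mul (by fun_prop)
      ((Complex.measurable_re.comp hφm).const_mul _)))
      (Eventually.of_forall (hre_bd δ hδ))
  have hR2 : Tendsto (fun δ : ℝ => ∫ t in Ioi (0 : ℝ), Real.exp (-(δ ^ 2 * t)) *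
      (δ ^ 2 * (φ t).re)) (𝓝[>] 0) (𝓝 0) := by
    -- The term δ/2 is δ³ times the integral 1/(2δ²) of exp(−2δ²t).
    refine squeeze_zero_norm' (a := fun δ => δ / 2 + δ * ∫ t in Ioi (0 : ℝ), ‖φ t‖ ^ 2) ?_ ?_
    · refine hpos.mono fun δ hδ => ?_
      refine (norm_integral_le_of_norm_le (hbint δ hδ)
        (Eventually.of_forall (hre_bd δ hδ))).trans (le_of_eq ?_)
      have h5 : ∫ t in Ioi (0 : ℝ), Real.exp (-(2 * δ ^ 2 * t)) = 1 / (2 * δ ^ 2) := by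
        have := integral_exp_neg_mul_mul_cos (by positivity : 0 < 2 * δ ^ 2) 0
        simp only [mul_zero, Real.cos_zero, mul_one] at this
        rw [this]; field_simp; simp
      rw [integral_add ((integrableOn_exp_neg_mul_Ioi
        (by positivity : 0 < 2 * δ ^ 2)).const_mul _) (hL2.const_mul _), integral_const_mul,
        integral_const_mul, h5]
      field_simp
      rfl
    · have : Continuous fun δ : ℝ => δ / 2 + δ * ∫ t in Ioi (0 : ℝ), ‖φ t‖ ^ 2 := by fun_prop
      have := this.tendsto 0
      simp only [zero_div, zero_mul, add_zero] at this
      exact this.mono_left nhdsWithin_le_nhds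
  have hR := hR1.add hR2
  have hLR := tendsto_nhds_unique (hL.congr' (hpos.mono fun δ hδ => ?_)) hR
  rotate_left
  · have h6 : IntegrableOn (fun t : ℝ => Real.exp (-(δ ^ 2 * t)) *
        (2 / Real.pi * (1 / t * (φ t).im))) (Ioi 0) := by
      refine (hint.const_mul (2 / Real.pi)).mono
        (((by fun_prop : Measurable fun t : ℝ =>
          Real.exp (-(δ ^ 2 * t))).aestronglyMeasurable).mul
          (hint.const_mul _).aestronglyMeasurable) ?_
      refine (ae_restrict_mem measurableSet_Ioi).mono fun t (ht : 0 < t) => ?_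
      rw [norm_mul, Real.norm_eq_abs (Real.exp _), abs_of_pos (Real.exp_pos _)]
      exact mul_le_of_le_one_left (norm_nonneg _) (Real.exp_le_one_iff.mpr (by
        have := mul_nonneg (sq_nonneg δ) ht.le; linarith))
    rw [(integral_sum_arctan_div hmeas hcard hW hX (pow_pos hδ 2)).2,
      ← integral_add h6 (hreint δ hδ)]
    refine integral_congr_ae (Eventually.of_forall fun t => ?_)
    simp only [hφ]
    ring
  -- Measurability of the number of negative members is not assumed; it is inherited from the
  -- arctangent sums, whose pointwise limit this is.
  have hmD : Integrable (fun ω => ((P ω).card : ℝ)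
      - 2 * (((P ω).filter (fun p => X ω p < 0)).card : ℝ)) μ := by
    refine (hcard.mul_const 2).mono' (aestronglyMeasurable_of_tendsto_ae (𝓝[>] (0 : ℝ)) hmδ
      (Eventually.of_forall hlim)) (Eventually.of_forall fun ω => ?_)
    exact le_of_tendsto (hlim ω).norm (Eventually.of_forall fun δ => hbd δ ω)
  have hfin : ∫ ω, (((P ω).filter (fun p => X ω p < 0)).card : ℝ) ∂μ
      = ((∫ ω, ((P ω).card : ℝ) ∂μ) - ∫ ω, (((P ω).card : ℝ)
      - 2 * (((P ω).filter (fun p => X ω p < 0)).card : ℝ)) ∂μ) / 2 := by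
    rw [← integral_sub hcard hmD, ← integral_div]
    refine integral_congr_ae (Eventually.of_forall fun ω => ?_)
    simp only
    ring
  rw [hfin, hLR, integral_const_mul]
  ring

end Inversion

/-! ### Square integrability of characteristic functions of bounded densities. -/

section SquareIntegrable

open Set Filter Topology

theorem integral_gaussian_sub {b : ℝ} (hb : 0 < b) (u : ℝ) :
    Integrable (fun v : ℝ => Real.exp (-(u - v) ^ 2 / (4 * b))) ∧
    ∫ v : ℝ, Real.exp (-(u - v) ^ 2 / (4 * b)) = Real.sqrt (4 * Real.pi * b) := by
  have h1 : ∀ v : ℝ, Real.exp (-(u - v) ^ 2 / (4 * b)) = Real.exp (-(4 * b)⁻¹ * (v - u) ^ 2) := by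
    intro v; congr 1; field_simp; ring
  simp only [h1]
  refine ⟨(integrable_exp_neg_mul_sq (by positivity)).comp_sub_right u, ?_⟩
  rw [integral_sub_right_eq_self (fun v : ℝ => Real.exp (-(4 * b)⁻¹ * v ^ 2)) u,
    integral_gaussian]
  congr 1
  field_simp

/-- Expand |charFun|² as a double integral over ν × ν and integrate in t first: a Gaussian in u − v
remains. Bounding one copy of ν by C times Lebesgue measure integrates it out. The widths cancel,
√(π/b)·√(4πb) = 2π, so the bound is uniform in b. -/
theorem integral_sq_norm_charFun_mul_gaussian_le {ν : Measure ℝ} [IsFiniteMeasure ν] {C : NNReal}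
    (hν : ν ≤ C • (volume : Measure ℝ)) {b : ℝ} (hb : 0 < b) :
    ∫ t : ℝ, ‖charFun ν t‖ ^ 2 * Real.exp (-b * t ^ 2) ≤ 2 * Real.pi * C * ν.real univ := by
  have hgauss : Integrable fun t : ℝ => Real.exp (-b * t ^ 2) := integrable_exp_neg_mul_sq hb
  have hF : Integrable (Function.uncurry fun (t : ℝ) (z : ℝ × ℝ) =>
      Complex.exp (Complex.I * ((z.1 - z.2 : ℝ) : ℂ) * t) * Complex.exp (-b * t ^ 2))
      (volume.prod (ν.prod ν)) := by
    have h0 : Integrable (fun p : ℝ × ℝ × ℝ => Real.exp (-b * p.1 ^ 2) * 1)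
        (volume.prod (ν.prod ν)) := hgauss.mul_prod (integrable_const 1)
    refine h0.mono' (Continuous.aestronglyMeasurable (by fun_prop)) (Eventually.of_forall fun p => ?_)
    rw [Function.uncurry, norm_mul]
    have e1 : Complex.I * ((p.2.1 - p.2.2 : ℝ) : ℂ) * p.1
        = (((p.2.1 - p.2.2) * p.1 : ℝ) : ℂ) * Complex.I := by push_cast; ring
    have e2 : (-b * p.1 ^ 2 : ℂ) = ((-b * p.1 ^ 2 : ℝ) : ℂ) := by push_cast; ring
    rw [e1, e2, Complex.norm_exp_ofReal_mul_I, ← Complex.ofReal_exp, Complex.norm_real,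
      Real.norm_eq_abs, abs_of_pos (Real.exp_pos _), mul_comm]
  have hsq : ∀ t : ℝ, ((‖charFun ν t‖ ^ 2 * Real.exp (-b * t ^ 2) : ℝ) : ℂ)
      = ∫ z, Complex.exp (Complex.I * ((z.1 - z.2 : ℝ) : ℂ) * t) * Complex.exp (-b * t ^ 2)
          ∂(ν.prod ν) := by
    intro t
    have e3 : ∀ z : ℝ × ℝ, Complex.exp (Complex.I * ((z.1 - z.2 : ℝ) : ℂ) * t)
        = Complex.exp (t * z.1 * Complex.I) * Complex.exp (((-t : ℝ) : ℂ) * z.2 * Complex.I) := by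
      intro z; rw [← Complex.exp_add]; congr 1; push_cast; ring
    rw [integral_mul_const]
    simp only [e3]
    rw [integral_prod_mul (fun x : ℝ => Complex.exp (t * x * Complex.I))
      (fun x : ℝ => Complex.exp (((-t : ℝ) : ℂ) * x * Complex.I)),
      ← charFun_apply_real, ← charFun_apply_real, charFun_neg, Complex.mul_conj,
      Complex.normSq_eq_norm_sq]
    push_cast
    ring
  have hswap := integral_integral_swap hF
  simp only [← hsq] at hswap
  have hin : ∀ z : ℝ × ℝ, ∫ t : ℝ, Complex.exp (Complex.I * ((z.1 - z.2 : ℝ) : ℂ) * t)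
      * Complex.exp (-b * t ^ 2) = ((Real.sqrt (Real.pi / b)
        * Real.exp (-(z.1 - z.2) ^ 2 / (4 * b)) : ℝ) : ℂ) := by
    intro z
    rw [fourierIntegral_gaussian (by simpa using hb)]
    have e4 : (Real.pi / b : ℂ) ^ (1 / 2 : ℂ) = ((Real.sqrt (Real.pi / b) : ℝ) : ℂ) := by
      rw [Real.sqrt_eq_rpow, Complex.ofReal_cpow (by positivity)]
      push_cast; rfl
    rw [e4]
    push_cast
    rfl
  simp only [hin] at hswap
  rw [integral_complex_ofReal, integral_complex_ofReal] at hswap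
  rw [Complex.ofReal_injective hswap]
  have hint2 : Integrable (fun z : ℝ × ℝ => Real.sqrt (Real.pi / b)
      * Real.exp (-(z.1 - z.2) ^ 2 / (4 * b))) (ν.prod ν) := by
    refine Integrable.mono' (integrable_const (Real.sqrt (Real.pi / b)))
      (Continuous.aestronglyMeasurable (by fun_prop)) (Eventually.of_forall fun z => ?_)
    rw [norm_mul, Real.norm_eq_abs, Real.norm_eq_abs, abs_of_nonneg (Real.sqrt_nonneg _),
      abs_of_pos (Real.exp_pos _)]
    refine mul_le_of_le_one_right (Real.sqrt_nonneg _) (Real.exp_le_one_iff.mpr ?_)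
    exact div_nonpos_of_nonpos_of_nonneg (by nlinarith [sq_nonneg (z.1 - z.2)]) (by positivity)
  rw [integral_prod _ hint2]
  have hinner : ∀ u : ℝ, ∫ v, Real.sqrt (Real.pi / b) * Real.exp (-(u - v) ^ 2 / (4 * b)) ∂ν
      ≤ 2 * Real.pi * C := by
    intro u
    have hg := integral_gaussian_sub hb u
    have h1 : ∫ v, Real.exp (-(u - v) ^ 2 / (4 * b)) ∂ν
        ≤ ∫ v, Real.exp (-(u - v) ^ 2 / (4 * b)) ∂(C • (volume : Measure ℝ)) :=
      integral_mono_measure hν (Eventually.of_forall fun v => (Real.exp_pos _).le)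
        (hg.1.smul_measure_nnreal)
    rw [integral_smul_nnreal_measure, hg.2] at h1
    rw [integral_const_mul]
    refine (mul_le_mul_of_nonneg_left h1 (Real.sqrt_nonneg _)).trans (le_of_eq ?_)
    have e5 : Real.sqrt (Real.pi / b) * Real.sqrt (4 * Real.pi * b) = 2 * Real.pi := by
      rw [← Real.sqrt_mul (by positivity)]
      have : Real.pi / b * (4 * Real.pi * b) = (2 * Real.pi) ^ 2 := by field_simp; ring
      rw [this, Real.sqrt_sq (by positivity)]
    rw [NNReal.smul_def, smul_eq_mul]
    linear_combination (C : ℝ) * e5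
  calc _ ≤ ∫ _ : ℝ, 2 * Real.pi * (C : ℝ) ∂ν :=
        integral_mono hint2.integral_prod_left (integrable_const _) hinner
    _ = _ := by rw [integral_const, smul_eq_mul, mul_comm]

/-- The characteristic function of a finite measure with bounded density is square integrable. -/
theorem integrable_sq_norm_charFun {ν : Measure ℝ} [IsFiniteMeasure ν] {C : NNReal}
    (hν : ν ≤ C • (volume : Measure ℝ)) : Integrable fun t : ℝ => ‖charFun ν t‖ ^ 2 := by
  have hcont : Measurable fun t : ℝ => ‖charFun ν t‖ ^ 2 :=
    (stronglyMeasurable_charFun.measurable.norm).pow_const 2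
  have hbd : ∀ t : ℝ, ‖charFun ν t‖ ^ 2 ≤ ν.real univ ^ 2 := fun t => by
    gcongr; exact norm_charFun_le t
  have hcov : AECover (volume : Measure ℝ) atTop fun n : ℕ => Metric.closedBall (0 : ℝ) n :=
    aecover_closedBall tendsto_natCast_atTop_atTop
  -- On the ball of radius n, the choice b = 1/(n+1)² gives bt² ≤ 1, so removing the Gaussian weight
  -- costs at most a factor e.
  refine hcov.integrable_of_integral_norm_bounded
    (Real.exp 1 * (2 * Real.pi * C * ν.real univ)) (fun n => ?_) (Eventually.of_forall fun n => ?_)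
  · refine Measure.integrableOn_of_bounded measure_closedBall_lt_top.ne hcont.aestronglyMeasurable
      (M := ν.real univ ^ 2) (Eventually.of_forall fun t => ?_)
    rw [norm_pow, norm_norm]; exact hbd t
  · have hb : 0 < 1 / ((n : ℝ) + 1) ^ 2 := by positivity
    have hi : Integrable fun t : ℝ => Real.exp 1 *
        (‖charFun ν t‖ ^ 2 * Real.exp (-(1 / ((n : ℝ) + 1) ^ 2) * t ^ 2)) := by
      refine Integrable.const_mul ?_ _
      refine (integrable_exp_neg_mul_sq hb).bdd_mul hcont.aestronglyMeasurable
        (c := ν.real univ ^ 2) (Eventually.of_forall fun t => ?_)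
      rw [norm_pow, norm_norm]; exact hbd t
    refine le_trans ?_ (mul_le_mul_of_nonneg_left (integral_sq_norm_charFun_mul_gaussian_le hν hb)
      (Real.exp_pos 1).le)
    rw [← integral_const_mul]
    refine le_trans ?_ (setIntegral_le_integral (s := Metric.closedBall (0 : ℝ) n) hi
      (Eventually.of_forall fun t => by positivity))
    refine setIntegral_mono_on ?_ hi.integrableOn measurableSet_closedBall fun t ht => ?_
    · refine Measure.integrableOn_of_bounded measure_closedBall_lt_top.ne
        hcont.norm.aestronglyMeasurable
        (M := ν.real univ ^ 2) (Eventually.of_forall fun t => ?_)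
      rw [norm_norm, norm_pow, norm_norm]; exact hbd t
    · rw [norm_pow, norm_norm, mul_left_comm]
      refine le_mul_of_one_le_right (by positivity) ?_
      rw [← Real.exp_add]
      refine Real.one_le_exp ?_
      rw [mem_closedBall_zero_iff, Real.norm_eq_abs] at ht
      have : t ^ 2 ≤ ((n : ℝ) + 1) ^ 2 := by
        rw [← sq_abs]; gcongr; linarith
      have : 1 / ((n : ℝ) + 1) ^ 2 * t ^ 2 ≤ 1 := by
        rw [one_div_mul_eq_div]; exact div_le_one_of_le₀ this (by positivity)
      linarith

theorem hasDerivAt_mul_sq_add_rpow {h : ℝ} (hh : 0 < h) (w β y : ℝ) :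
    HasDerivAt (fun y : ℝ => w * (y ^ 2 + h ^ 2) ^ (-β))
      (-(2 * w * β * y * (y ^ 2 + h ^ 2) ^ (-β - 1))) y := by
  have h1 : HasDerivAt (fun y : ℝ => y ^ 2 + h ^ 2) (2 * y) y := by
    simpa using (hasDerivAt_pow 2 y).add_const (h ^ 2)
  refine ((h1.rpow_const (p := -β) (Or.inl (by positivity))).const_mul w).congr_deriv ?_
  ring

/-- In polar coordinates the image measure comes from y dy on (0, R) under the radial profile f. The
derivative f′ vanishes at 0, but only like y, and the planar area element carries the same factor:
|f′(y)| ≥ c·y on (0, R). Changing variables along the injective f then bounds the density by a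
multiple of 1/c. -/
theorem map_pathloss_restrict_le {w h β : ℝ} (hw : 0 < w) (hh : 0 < h) (hβ : 0 < β)
    {B : Set Plane} {R : ℝ} (hR : 0 < R) (hBR : B ⊆ Metric.ball 0 R) :
    ∃ C : NNReal, (volume.restrict B).map (fun x : Plane => w * (‖x‖ ^ 2 + h ^ 2) ^ (-β))
      ≤ C • (volume : Measure ℝ) := by
  set f : ℝ → ℝ := fun y => w * (y ^ 2 + h ^ 2) ^ (-β) with hf
  have hfm : Measurable f := by fun_prop
  have hpos : ∀ y : ℝ, 0 < y ^ 2 + h ^ 2 := fun y => by positivity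
  -- This is |f′(y)|/y at y = R, its minimum on (0, R], because the exponent −β − 1 is negative.
  set c : ℝ := 2 * w * β * (R ^ 2 + h ^ 2) ^ (-β - 1) with hc
  have hcpos : 0 < c := by have := hpos R; positivity
  set V : ℝ := (volume : Measure Plane).real (Metric.ball 0 1)
  refine ⟨(2 * V * (1 / c)).toNNReal, Measure.le_iff.mpr fun A hA => ?_⟩
  have hfn : Measurable fun x : Plane => f ‖x‖ := hfm.comp measurable_norm
  rw [Measure.map_apply hfn hA, Measure.restrict_apply (hfn hA)]
  set g : ℝ → ℝ := (Iio R ∩ f ⁻¹' A).indicator 1 with hg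
  have hset : (fun x : Plane => f ‖x‖) ⁻¹' A ∩ B ⊆
      Metric.ball (0 : Plane) R ∩ (fun x : Plane => f ‖x‖) ⁻¹' A :=
    fun x hx => ⟨hBR hx.2, hx.1⟩
  refine (measure_mono hset).trans ?_
  have hm : MeasurableSet (Metric.ball (0 : Plane) R ∩ (fun x : Plane => f ‖x‖) ⁻¹' A) :=
    measurableSet_ball.inter (hfn hA)
  have hfinite : volume (Metric.ball (0 : Plane) R ∩ (fun x : Plane => f ‖x‖) ⁻¹' A) ≠ ⊤ :=
    ((measure_mono inter_subset_left).trans_lt measure_ball_lt_top).ne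
  rw [← ENNReal.ofReal_toReal hfinite, ← measureReal_def, ← integral_indicator_one hm]
  have h1 : ∀ x : Plane, (Metric.ball (0 : Plane) R ∩ (fun x : Plane => f ‖x‖) ⁻¹' A).indicator
      (1 : Plane → ℝ) x = g ‖x‖ := by
    intro x
    have hiff : x ∈ Metric.ball (0 : Plane) R ∩ (fun x : Plane => f ‖x‖) ⁻¹' A
        ↔ ‖x‖ ∈ Iio R ∩ f ⁻¹' A := by
      rw [mem_inter_iff, mem_ball_zero_iff]; rfl
    by_cases hx : ‖x‖ ∈ Iio R ∩ f ⁻¹' A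
    · rw [hg, indicator_of_mem hx, indicator_of_mem (hiff.2 hx)]; rfl
    · rw [hg, indicator_of_notMem hx, indicator_of_notMem (hiff.not.2 hx)]
  simp only [h1]
  rw [integral_fun_norm_addHaar]
  simp only [finrank_euclideanSpace, Fintype.card_fin, Nat.add_one_sub_one, pow_one, smul_eq_mul,
    nsmul_eq_mul, Nat.cast_ofNat]
  have h2 : ∫ y in Ioi (0 : ℝ), y * g y = ∫ y in Ioo 0 R, y * A.indicator 1 (f y) := by
    rw [← integral_indicator measurableSet_Ioi, ← integral_indicator measurableSet_Ioo]
    refine integral_congr_ae (Eventually.of_forall fun y => ?_)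
    simp only [hg, indicator, mem_Ioi, mem_Ioo, mem_inter_iff, mem_Iio, mem_preimage]
    by_cases a1 : 0 < y <;> by_cases a2 : y < R <;> by_cases a3 : f y ∈ A <;> simp [a1, a2, a3]
  have hAm : Measurable fun y => A.indicator (1 : ℝ → ℝ) (f y) := (measurable_one.indicator hA).comp hfm
  have hA0 : ∀ y, 0 ≤ A.indicator (1 : ℝ → ℝ) (f y) := fun y =>
    indicator_nonneg (fun _ _ => zero_le_one) _
  have hA1 : ∀ y, A.indicator (1 : ℝ → ℝ) (f y) ≤ 1 := fun y =>
    indicator_le_self' (fun _ _ => zero_le_one) _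
  have h3 : IntegrableOn (fun y : ℝ => y * A.indicator 1 (f y)) (Ioo 0 R) := by
    refine Measure.integrableOn_of_bounded measure_Ioo_lt_top.ne
      (measurable_id.mul hAm).aestronglyMeasurable (M := R) ?_
    refine (ae_restrict_mem measurableSet_Ioo).mono fun y hy => ?_
    rw [norm_mul, Real.norm_eq_abs, Real.norm_eq_abs, abs_of_pos hy.1, abs_of_nonneg (hA0 y)]
    exact (mul_le_of_le_one_right hy.1.le (hA1 y)).trans hy.2.le
  have h4 : ENNReal.ofReal (∫ y in Ioo 0 R, y * A.indicator 1 (f y))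
      ≤ ENNReal.ofReal (1 / c) * volume A := by
    rw [ofReal_integral_eq_lintegral_ofReal h3 ((ae_restrict_mem measurableSet_Ioo).mono
      fun y hy => mul_nonneg hy.1.le (hA0 y))]
    have hinj : InjOn f (Ioo 0 R) := by
      refine StrictAntiOn.injOn fun y hy z hz hyz => ?_
      refine mul_lt_mul_of_pos_left ?_ hw
      refine Real.rpow_lt_rpow_of_neg (hpos y) ?_ (by linarith)
      have := hy.1
      gcongr
    have hcv := lintegral_image_eq_lintegral_abs_deriv_mul measurableSet_Ioo
      (fun y _ => (hasDerivAt_mul_sq_add_rpow hh w β y).hasDerivWithinAt) hinj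
      (A.indicator (1 : ℝ → ENNReal))
    calc ∫⁻ y in Ioo 0 R, ENNReal.ofReal (y * A.indicator 1 (f y))
        ≤ ∫⁻ y in Ioo 0 R, ENNReal.ofReal (1 / c) *
          (ENNReal.ofReal |(-(2 * w * β * y * (y ^ 2 + h ^ 2) ^ (-β - 1)))|
            * A.indicator 1 (f y)) := by
          refine setLIntegral_mono' measurableSet_Ioo fun y hy => ?_
          by_cases hyA : f y ∈ A
          · simp only [indicator_of_mem hyA, Pi.one_apply, mul_one]
            rw [← ENNReal.ofReal_mul (by positivity)]
            refine ENNReal.ofReal_le_ofReal ?_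
            have hy0 := hy.1
            have hp := hpos y
            rw [abs_neg, abs_of_nonneg (by positivity), one_div_mul_eq_div, le_div_iff₀ hcpos, hc]
            have : (R ^ 2 + h ^ 2) ^ (-β - 1) ≤ (y ^ 2 + h ^ 2) ^ (-β - 1) := by
              refine Real.rpow_le_rpow_of_nonpos hp ?_ (by linarith)
              have := hy.2
              gcongr
            calc y * (2 * w * β * (R ^ 2 + h ^ 2) ^ (-β - 1))
                = 2 * w * β * y * (R ^ 2 + h ^ 2) ^ (-β - 1) := by ring
              _ ≤ _ := by gcongr
          · simp [indicator_of_notMem hyA]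
      _ = ENNReal.ofReal (1 / c) * ∫⁻ x in f '' Ioo 0 R, A.indicator 1 x := by
          rw [hcv, lintegral_const_mul']
          exact ENNReal.ofReal_ne_top
      _ ≤ ENNReal.ofReal (1 / c) * volume A := by
          gcongr
          refine (setLIntegral_le_lintegral _ _).trans (le_of_eq ?_)
          rw [lintegral_indicator_one hA]
  rw [h2, ENNReal.ofReal_mul (by norm_num), ENNReal.ofReal_mul (by positivity)]
  have hfinal : (((2 * V * (1 / c)).toNNReal • (volume : Measure ℝ)) A : ENNReal)
      = ENNReal.ofReal 2 * (ENNReal.ofReal V * (ENNReal.ofReal (1 / c) * volume A)) := by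
    rw [Measure.smul_apply, ENNReal.smul_def, smul_eq_mul, ← ENNReal.ofReal, mul_assoc 2 V,
      ENNReal.ofReal_mul (by norm_num), ENNReal.ofReal_mul (by positivity)]
    ring
  rw [hfinal]
  gcongr

theorem integrable_sq_norm_setIntegral_exp_pathloss {w h β : ℝ} (hw : 0 < w) (hh : 0 < h)
    (hβ : 0 < β) {B : Set Plane} {R : ℝ} (hR : 0 < R)
    (hBR : B ⊆ Metric.ball 0 R) :
    Integrable fun t : ℝ => ‖∫ x in B,
      Complex.exp (-(Complex.I * t) * ((w * (‖x‖ ^ 2 + h ^ 2) ^ (-β) : ℝ) : ℂ))‖ ^ 2 := by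
  obtain ⟨C, hC⟩ := map_pathloss_restrict_le hw hh hβ hR hBR
  have hfm : Measurable fun x : Plane => w * (‖x‖ ^ 2 + h ^ 2) ^ (-β) := by fun_prop
  have : IsFiniteMeasure (volume.restrict B) :=
    ⟨by rw [Measure.restrict_apply_univ]; exact (measure_mono hBR).trans_lt measure_ball_lt_top⟩
  have h1 := (integrable_sq_norm_charFun hC).comp_neg
  refine h1.congr (Eventually.of_forall fun t => ?_)
  simp only
  rw [charFun_apply_real, integral_map hfm.aemeasurable
    (Continuous.aestronglyMeasurable (by fun_prop))]
  congr 2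
  refine integral_congr_ae (Eventually.of_forall fun x => ?_)
  simp only
  congr 1
  push_cast
  ring

end SquareIntegrable

/-! ### Moments and generating functions of the Poisson law. -/

section PoissonMoments

open scoped Nat

theorem summable_poisson_mul_sq (r : NNReal) :
    Summable fun n : ℕ => Real.exp (-r) * (r : ℝ) ^ n / n ! * ‖((n : ℝ) ^ 2)‖ := by
  have h := (NormedSpace.expSeries_div_summable (4 * (r : ℝ))).mul_left (Real.exp (-r))
  refine Summable.of_nonneg_of_le (fun n => by positivity) (fun n => ?_) h
  have h2 : (n : ℝ) ^ 2 ≤ 4 ^ n := by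
    have : (n : ℝ) ≤ 2 ^ n := by exact_mod_cast Nat.lt_two_pow_self.le
    calc (n : ℝ) ^ 2 ≤ (2 ^ n) ^ 2 := by gcongr
      _ = 4 ^ n := by rw [← pow_mul, mul_comm, pow_mul]; norm_num
  rw [Real.norm_of_nonneg (by positivity), mul_div_assoc, mul_assoc, mul_pow]
  gcongr
  rw [div_mul_eq_mul_div, mul_comm]
  gcongr

theorem integrable_sq_poissonMeasure (r : NNReal) :
    Integrable (fun n : ℕ => (n : ℝ) ^ 2) (poissonMeasure r) :=
  integrable_poissonMeasure_iff.mpr (summable_poisson_mul_sq r)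

theorem integrable_id_poissonMeasure (r : NNReal) :
    Integrable (fun n : ℕ => (n : ℝ)) (poissonMeasure r) := by
  refine (integrable_sq_poissonMeasure r).mono' Measurable.of_discrete.aestronglyMeasurable
    (Filter.Eventually.of_forall fun n => ?_)
  rw [Real.norm_of_nonneg (by positivity)]
  exact_mod_cast Nat.le_self_pow two_ne_zero n

theorem integral_pow_poissonMeasure (r : NNReal) (z : ℂ) :
    ∫ n : ℕ, z ^ n ∂(poissonMeasure r) = Complex.exp (r * (z - 1)) := by
  rw [integral_poissonMeasure]
  have : ∀ n : ℕ, (Real.exp (-r) * (r : ℝ) ^ n / n ! : ℝ) • z ^ n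
      = (Real.exp (-r) : ℂ) * ((r * z) ^ n / n !) := by
    intro n
    rw [Complex.real_smul, mul_pow]
    push_cast
    ring
  simp only [this]
  rw [tsum_mul_left, (NormedSpace.expSeries_div_hasSum_exp (r * z)).tsum_eq,
    ← Complex.exp_eq_exp_ℂ, Complex.ofReal_exp, ← Complex.exp_add]
  congr 1
  push_cast
  ring

theorem integral_mul_pow_poissonMeasure (r : NNReal) {z : ℂ} (hz : ‖z‖ ≤ 1) :
    ∫ n : ℕ, (n : ℂ) * z ^ n ∂(poissonMeasure r) = r * z * Complex.exp (r * (z - 1)) := by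
  have hint : Integrable (fun n : ℕ => (n : ℂ) * z ^ n) (poissonMeasure r) := by
    refine (integrable_id_poissonMeasure r).mono' Measurable.of_discrete.aestronglyMeasurable
      (Filter.Eventually.of_forall fun n => ?_)
    rw [norm_mul, norm_pow, Complex.norm_natCast]
    exact mul_le_of_le_one_right (by positivity) (pow_le_one₀ (norm_nonneg _) hz)
  have hs := hasSum_integral_poissonMeasure hint
  -- The term n = 0 vanishes; after the shift, (n+1)/(n+1)! = 1/n! restores the exponential series.
  have h0 := (hasSum_nat_add_iff' 1).mpr hs
  simp only [Finset.range_one, Finset.sum_singleton, Nat.cast_zero, zero_mul, smul_zero,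
    sub_zero] at h0
  refine h0.unique ?_
  have hpow : HasSum (fun n : ℕ => (Real.exp (-r) : ℂ) * ((r * z) ^ n / n !))
      (Complex.exp (r * (z - 1))) := by
    have := (NormedSpace.expSeries_div_hasSum_exp (r * z)).mul_left (Real.exp (-r) : ℂ)
    rw [← Complex.exp_eq_exp_ℂ, Complex.ofReal_exp, ← Complex.exp_add] at this
    rw [show ((r : ℂ) * (z - 1)) = ((-r : ℝ) : ℂ) + r * z by push_cast; ring]
    simpa only [Complex.ofReal_exp] using this
  refine (hpow.mul_left (r * z)).congr_fun fun n => ?_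
  rw [Complex.real_smul, Nat.factorial_succ]
  have h1 : ((n : ℂ) + 1) ≠ 0 := Nat.cast_add_one_ne_zero n
  have h2 : ((n ! : ℕ) : ℂ) ≠ 0 := by exact_mod_cast Nat.factorial_ne_zero n
  push_cast
  field_simp
  ring

end PoissonMoments

/-! ### Exponentially tilted means of independent sums. -/

section IndependentProducts

variable {Ω κ : Type*} [MeasurableSpace Ω] {μ : Measure Ω} [Fintype κ]

/-- If in each coordinate the weight `V i` tilts the mean of `U i` to `a i`, then the product
weight tilts the mean of the sum to the sum of the `a i`. -/
theorem iIndepFun.integral_sum_mul_prod {U V : κ → Ω → ℂ}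
    (hind : iIndepFun (fun i ω => (U i ω, V i ω)) μ) (hU : ∀ i, Integrable (U i) μ)
    (hUm : ∀ i, Measurable (U i)) (hVm : ∀ i, Measurable (V i)) (hV : ∀ i ω, ‖V i ω‖ ≤ 1)
    {a : κ → ℂ} (ha : ∀ i, ∫ ω, U i ω * V i ω ∂μ = a i * ∫ ω, V i ω ∂μ) :
    ∫ ω, ∏ i, V i ω ∂μ = ∏ i, ∫ ω, V i ω ∂μ ∧
    ∫ ω, (∑ i, U i ω) * ∏ i, V i ω ∂μ = (∑ i, a i) * ∏ i, ∫ ω, V i ω ∂μ := by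
  classical
  have hZ : ∀ i, AEMeasurable (fun ω => (U i ω, V i ω)) μ := fun i =>
    ((hUm i).prodMk (hVm i)).aemeasurable
  refine ⟨hind.integral_fun_prod_comp hZ (f := fun _ z => z.2)
    fun i => measurable_snd.aestronglyMeasurable, ?_⟩
  have hprod : ∀ j, ∫ ω, U j ω * ∏ i, V i ω ∂μ = a j * ∏ i, ∫ ω, V i ω ∂μ := by
    intro j
    -- `U j` is paired with `V j` inside the single factor j, so independence between coordinates
    -- suffices; `U j` and `V j` may be dependent.
    have h := hind.integral_fun_prod_comp hZ
      (f := fun i z => if i = j then z.1 * z.2 else z.2)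
      (fun i => Measurable.aestronglyMeasurable (by split_ifs <;> fun_prop))
    have h1 : ∀ ω, ∏ i, (if i = j then U i ω * V i ω else V i ω) = U j ω * ∏ i, V i ω := by
      intro ω
      rw [← Finset.mul_prod_erase _ _ (Finset.mem_univ j),
        ← Finset.mul_prod_erase _ (fun i => V i ω) (Finset.mem_univ j), if_pos rfl, mul_assoc]
      congr 2
      exact Finset.prod_congr rfl fun i hi => if_neg (Finset.ne_of_mem_erase hi)
    simp only [h1] at h
    rw [h, ← Finset.mul_prod_erase _ _ (Finset.mem_univ j),
      ← Finset.mul_prod_erase _ (fun i => ∫ ω, V i ω ∂μ) (Finset.mem_univ j), ← mul_assoc, ← ha j]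
    congr 1
    · simp
    · exact Finset.prod_congr rfl fun i hi => by simp [Finset.ne_of_mem_erase hi]
  have hbd : ∀ ω, ‖∏ i, V i ω‖ ≤ 1 := fun ω => by
    rw [norm_prod]
    exact Finset.prod_le_one (fun _ _ => norm_nonneg _) fun i _ => hV i ω
  simp only [Finset.sum_mul]
  rw [integral_finsetSum _ fun j _ => (hU j).mul_bdd (c := 1)
    (Finset.measurable_fun_prod _ fun i _ => hVm i).aestronglyMeasurable
    (Filter.Eventually.of_forall hbd)]
  exact Finset.sum_congr rfl fun j _ => hprod j

end IndependentProducts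

/-! ### Campbell's formula for one Poisson process. -/

section Campbell

open Filter Topology

variable {Ω E : Type*}

open scoped Classical in
/-- The points of `Φ` in `F`, as a finite set (empty if there are infinitely many). -/
noncomputable def pointsIn (Φ : Ω → Set E) (F : Set E) (ω : Ω) : Finset E :=
  if h : (Φ ω ∩ F).Finite then h.toFinset else ∅

theorem coe_pointsIn {Φ : Ω → Set E} {F : Set E} {ω : Ω} (h : (Φ ω ∩ F).Finite) :
    (pointsIn Φ F ω : Set E) = Φ ω ∩ F := by
  rw [pointsIn, dif_pos h, Set.Finite.coe_toFinset]

theorem mem_pointsIn {Φ : Ω → Set E} {F : Set E} {ω : Ω} (h : (Φ ω ∩ F).Finite) {x : E} :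
    x ∈ pointsIn Φ F ω ↔ x ∈ Φ ω ∧ x ∈ F := by
  rw [← Finset.mem_coe, coe_pointsIn h, Set.mem_inter_iff]

theorem pointCount_inter_eq_card {Φ : Ω → Set E} {F : Set E} {ω : Ω} (h : (Φ ω ∩ F).Finite)
    (A : Set E) [DecidablePred (· ∈ A)] :
    pointCount Φ (F ∩ A) ω = ((pointsIn Φ F ω).filter (· ∈ A)).card := by
  rw [pointCount, ← Set.encard_coe_eq_coe_finsetCard]
  congr 1
  ext x
  simp only [Finset.coe_filter, mem_pointsIn h, Set.mem_inter_iff, Set.mem_ofPred_eq, and_assoc]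

theorem pointCount_eq_card {Φ : Ω → Set E} {F : Set E} {ω : Ω} (h : (Φ ω ∩ F).Finite) :
    pointCount Φ F ω = (pointsIn Φ F ω).card := by
  rw [pointCount, ← Set.encard_coe_eq_coe_finsetCard, coe_pointsIn h]

variable [MeasurableSpace E]

/-- Grouping points by the value of the simple function reduces a sum over random points to finitely
many counts on disjoint cells, whose joint law the definition of a Poisson process prescribes. -/
theorem sum_simpleFunc_pointsIn {G β : Type*} [AddCommMonoid G] {Φ : Ω → Set E} {F : Set E}
    {ω : Ω} (h : (Φ ω ∩ F).Finite) (s : SimpleFunc E β) (u : β → G) :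
    ∑ p ∈ pointsIn Φ F ω, u (s p)
      = ∑ v ∈ s.range, (pointCount Φ (F ∩ s ⁻¹' {v}) ω).toNat • u v := by
  classical
  rw [← Finset.sum_fiberwise_of_maps_to (g := s) (t := s.range) fun p _ => s.mem_range_self p]
  refine Finset.sum_congr rfl fun v _ => ?_
  rw [pointCount_inter_eq_card h, ENat.toNat_natCast,
    Finset.sum_congr rfl (g := fun _ => u v) fun p hp => by rw [(Finset.mem_filter.mp hp).2],
    Finset.sum_const]
  rfl

theorem measurable_pointCount_pointProcessSigma [MeasurableSpace Ω] (Φ : Ω → Set E) {A : Set E}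
    (hA : MeasurableSet A) : Measurable[pointProcessSigma Φ] (pointCount Φ A) := by
  have h : MeasurableSpace.comap (pointCount Φ A) inferInstance ≤ pointProcessSigma Φ :=
    le_iSup₂_of_le A hA le_rfl
  exact (comap_measurable _).mono h le_rfl

/-- Sums of a function over the points in `F` are measurable for the sigma-algebra of the
process. -/
theorem measurable_sum_pointsIn [MeasurableSpace Ω] {G : Type*} [NormedAddCommGroup G]
    [MeasurableSpace G] [BorelSpace G] [SecondCountableTopology G]
    {Φ : Ω → Set E} {F : Set E} (hF : MeasurableSet F) (hfin : ∀ ω, (Φ ω ∩ F).Finite)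
    {g : E → G} (hg : StronglyMeasurable g) :
    Measurable[pointProcessSigma Φ] fun ω => ∑ p ∈ pointsIn Φ F ω, g p := by
  let _ : MeasurableSpace Ω := pointProcessSigma Φ
  refine measurable_of_tendsto_metrizable (f := fun n ω => ∑ p ∈ pointsIn Φ F ω, hg.approx n p)
    (fun n => ?_) (tendsto_pi_nhds.mpr fun ω => tendsto_finsetSum _ fun p _ =>
      hg.tendsto_approx p)
  have h1 := fun ω => sum_simpleFunc_pointsIn (hfin ω) (hg.approx n) id
  simp only [id] at h1
  simp only [h1]
  refine Finset.measurable_fun_sum _ fun v _ => ?_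
  have h2 := measurable_pointCount_pointProcessSigma Φ
    (hF.inter ((hg.approx n).measurableSet_fiber v))
  exact (Measurable.of_discrete (f := fun m : ℕ∞ => m.toNat • v)).comp h2

theorem pointProcessSigma_le {mΩ : MeasurableSpace Ω} [TopologicalSpace E] {Φ : Ω → Set E}
    {Λ : Measure E} {μ : Measure Ω} (h : IsPoissonPointProcess Φ Λ μ) :
    pointProcessSigma Φ ≤ mΩ :=
  iSup₂_le fun A hA => (h.measurable_count A hA).comap_le

theorem integral_comp_simpleFunc {β : Type*} (m : Measure E) [IsFiniteMeasure m]
    (s : SimpleFunc E β) (u : β → ℂ) :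
    ∫ x, u (s x) ∂m = ∑ v ∈ s.range, (m.real (s ⁻¹' {v}) : ℂ) * u v := by
  classical
  have h1 : ∀ x, u (s x) = ∑ v ∈ s.range, (s ⁻¹' {v}).indicator (fun _ => u v) x := by
    intro x
    rw [Finset.sum_eq_single_of_mem (s x) (s.mem_range_self x)]
    · simp
    · intro v _ hv
      exact Set.indicator_of_notMem (fun hx => hv hx.symm) _
  simp only [h1]
  rw [integral_finsetSum _ fun v _ => (integrable_const _).indicator (s.measurableSet_fiber v)]
  refine Finset.sum_congr rfl fun v _ => ?_
  rw [integral_indicator_const _ (s.measurableSet_fiber v), Complex.real_smul]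

variable [MeasurableSpace Ω] [TopologicalSpace E] {Φ : Ω → Set E} {Λ : Measure E} {μ : Measure Ω}

theorem IsPoissonPointProcess.map_toNat (h : IsPoissonPointProcess Φ Λ μ) {A : Set E}
    (hA : MeasurableSet A) (hΛ : Λ A ≠ ⊤) :
    μ.map (fun ω => (pointCount Φ A ω).toNat) = poissonMeasure (Λ A).toNNReal := by
  have h1 : (fun ω => (pointCount Φ A ω).toNat) = ENat.toNat ∘ pointCount Φ A := rfl
  rw [h1, ← Measure.map_map Measurable.of_discrete (h.measurable_count A hA), h.count_law A hA hΛ,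
    Measure.map_map Measurable.of_discrete Measurable.of_discrete]
  have : ENat.toNat ∘ (fun n : ℕ => (n : ℕ∞)) = id := by ext n; simp
  rw [this, Measure.map_id]

theorem IsPoissonPointProcess.measurable_toNat (h : IsPoissonPointProcess Φ Λ μ) {A : Set E}
    (hA : MeasurableSet A) : Measurable fun ω => (pointCount Φ A ω).toNat :=
  (Measurable.of_discrete (f := ENat.toNat)).comp (h.measurable_count A hA)

theorem IsPoissonPointProcess.integral_comp_toNat (h : IsPoissonPointProcess Φ Λ μ) {A : Set E}
    (hA : MeasurableSet A) (hΛ : Λ A ≠ ⊤) (u : ℕ → ℂ) :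
    ∫ ω, u (pointCount Φ A ω).toNat ∂μ = ∫ n, u n ∂(poissonMeasure (Λ A).toNNReal) := by
  rw [← h.map_toNat hA hΛ, integral_map (h.measurable_toNat hA).aemeasurable
    Measurable.of_discrete.aestronglyMeasurable]

theorem IsPoissonPointProcess.integrable_comp_toNat (h : IsPoissonPointProcess Φ Λ μ) {A : Set E}
    (hA : MeasurableSet A) (hΛ : Λ A ≠ ⊤) {G : Type*} [NormedAddCommGroup G] {u : ℕ → G}
    (hu : Integrable u (poissonMeasure (Λ A).toNNReal)) :
    Integrable (fun ω => u (pointCount Φ A ω).toNat) μ := by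
  rw [← h.map_toNat hA hΛ] at hu
  exact hu.comp_measurable (h.measurable_toNat hA)

/-- On the level cells of `s` the counts are independent Poisson variables. The exponential factors
into powers of unimodular numbers `e v`, and each factor tilts the mean of its own count from Λ(A_v)
to Λ(A_v)·e_v; summing over cells rebuilds the integrals over `F`. -/
theorem IsPoissonPointProcess.campbell_simpleFunc (h : IsPoissonPointProcess Φ Λ μ)
    {F : Set E} (hF : MeasurableSet F) (hΛ : Λ F ≠ ⊤) (hfin : ∀ ω, (Φ ω ∩ F).Finite)
    (s : SimpleFunc E (ℝ × ℂ)) :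
    ∫ ω, Complex.exp (Complex.I * (∑ p ∈ pointsIn Φ F ω, (s p).1 : ℝ)) ∂μ
      = Complex.exp (∫ x in F, (Complex.exp (Complex.I * (s x).1) - 1) ∂Λ) ∧
    ∫ ω, (∑ p ∈ pointsIn Φ F ω, (s p).2) *
        Complex.exp (Complex.I * (∑ p ∈ pointsIn Φ F ω, (s p).1 : ℝ)) ∂μ
      = (∫ x in F, (s x).2 * Complex.exp (Complex.I * (s x).1) ∂Λ) *
        Complex.exp (∫ x in F, (Complex.exp (Complex.I * (s x).1) - 1) ∂Λ) := by
  have hfinm : IsFiniteMeasure (Λ.restrict F) := ⟨by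
    rw [Measure.restrict_apply_univ]; exact hΛ.lt_top⟩
  set A : s.range → Set E := fun v => F ∩ s ⁻¹' {v.1} with hAdef
  have hA : ∀ v, MeasurableSet (A v) := fun v => hF.inter (s.measurableSet_fiber v.1)
  have hΛA : ∀ v, Λ (A v) ≠ ⊤ := fun v => ne_top_of_le_ne_top hΛ (measure_mono Set.inter_subset_left)
  set n : s.range → Ω → ℕ := fun v ω => (pointCount Φ (A v) ω).toNat with hn
  have hreal : ∀ v : s.range, ((Λ.restrict F).real (s ⁻¹' {v.1}) : ℂ)
      = ((Λ (A v)).toNNReal : ℂ) := by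
    intro v
    rw [measureReal_def, Measure.restrict_apply (s.measurableSet_fiber v.1), Set.inter_comm]
    rfl
  set e : s.range → ℂ := fun v => Complex.exp (Complex.I * v.1.1) with he
  have henorm : ∀ v, ‖e v‖ = 1 := fun v => by
    simp only [he]; rw [mul_comm]; exact Complex.norm_exp_ofReal_mul_I _
  have hdisj : Pairwise fun v w : s.range => Disjoint (A v) (A w) := by
    intro v w hvw
    refine Set.disjoint_left.mpr fun x hx hx' => hvw (Subtype.ext ?_)
    exact hx.2.symm.trans hx'.2
  have hcount : iIndepFun (fun v => pointCount Φ (A v)) μ := by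
    have h1 := h.count_indep _ (fun i => A (s.range.equivFin.symm i)) (fun i => hA _)
      (fun i j hij => hdisj (s.range.equivFin.symm.injective.ne hij))
    have h2 := h1.precomp s.range.equivFin.injective
    simpa using h2
  have hind : iIndepFun (fun (v : s.range) ω => ((v.1.2 * n v ω : ℂ), e v ^ n v ω)) μ :=
    hcount.comp (fun v m => ((v.1.2 * m.toNat : ℂ), e v ^ m.toNat)) fun v => Measurable.of_discrete
  have hnm : ∀ v, Measurable (n v) := fun v => h.measurable_toNat (hA v)
  have hV : ∀ v, ∫ ω, e v ^ n v ω ∂μ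
      = Complex.exp ((Λ (A v)).toNNReal * (e v - 1)) := fun v => by
    rw [h.integral_comp_toNat (hA v) (hΛA v) (fun m => e v ^ m), integral_pow_poissonMeasure]
  have hUV : ∀ v : s.range, ∫ ω, (v.1.2 * n v ω : ℂ) * e v ^ n v ω ∂μ
      = ((Λ (A v)).toNNReal * (v.1.2 * e v)) * ∫ ω, e v ^ n v ω ∂μ := fun v => by
    rw [hV]
    simp only [mul_assoc]
    rw [integral_const_mul, h.integral_comp_toNat (hA v) (hΛA v) (fun m => m * e v ^ m),
      integral_mul_pow_poissonMeasure _ (henorm v).le]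
    ring
  have key := iIndepFun.integral_sum_mul_prod hind
    (fun v => (h.integrable_comp_toNat (hA v) (hΛA v) (u := fun m : ℕ => (m : ℂ))
      (by simpa using (integrable_id_poissonMeasure _).ofReal (𝕜 := ℂ))).const_mul _)
    (fun v => (Measurable.of_discrete (f := fun m : ℕ => (v.1.2 * m : ℂ))).comp (hnm v))
    (fun v => (Measurable.of_discrete (f := fun m : ℕ => e v ^ m)).comp (hnm v))
    (fun v ω => by rw [norm_pow, henorm, one_pow]) hUV
  have hsum2 : ∀ ω, ∑ p ∈ pointsIn Φ F ω, (s p).2 = ∑ v : s.range, (v.1.2 * n v ω : ℂ) := by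
    intro ω
    rw [sum_simpleFunc_pointsIn (hfin ω) s (fun v => v.2), ← Finset.sum_coe_sort]
    exact Finset.sum_congr rfl fun v _ => by rw [nsmul_eq_mul, mul_comm]
  have hexp : ∀ ω, Complex.exp (Complex.I * (∑ p ∈ pointsIn Φ F ω, (s p).1 : ℝ))
      = ∏ v : s.range, e v ^ n v ω := by
    intro ω
    rw [sum_simpleFunc_pointsIn (hfin ω) s (fun v => v.1), ← Finset.sum_coe_sort]
    push_cast
    rw [Finset.mul_sum, Complex.exp_sum]
    refine Finset.prod_congr rfl fun v _ => ?_
    rw [he, ← Complex.exp_nat_mul, nsmul_eq_mul]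
    congr 1
    ring
  have hprod : ∏ v : s.range, ∫ ω, e v ^ n v ω ∂μ
      = Complex.exp (∫ x in F, (Complex.exp (Complex.I * (s x).1) - 1) ∂Λ) := by
    rw [integral_comp_simpleFunc _ s (fun v => Complex.exp (Complex.I * v.1) - 1),
      ← Finset.sum_coe_sort, Complex.exp_sum]
    exact Finset.prod_congr rfl fun v _ => by rw [hV, hreal]
  have ha : ∑ v : s.range, ((Λ (A v)).toNNReal * (v.1.2 * e v) : ℂ)
      = ∫ x in F, (s x).2 * Complex.exp (Complex.I * (s x).1) ∂Λ := by
    rw [integral_comp_simpleFunc _ s (fun v => v.2 * Complex.exp (Complex.I * v.1)),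
      ← Finset.sum_coe_sort s.range]
    exact Finset.sum_congr rfl fun v _ => by rw [hreal]
  simp only [hsum2, hexp]
  rw [← hprod, ← ha]
  exact key

theorem IsPoissonPointProcess.integrable_card_sq (h : IsPoissonPointProcess Φ Λ μ)
    {F : Set E} (hF : MeasurableSet F) (hΛ : Λ F ≠ ⊤) (hfin : ∀ ω, (Φ ω ∩ F).Finite) :
    Integrable (fun ω => ((pointsIn Φ F ω).card : ℝ) ^ 2) μ := by
  have := h.integrable_comp_toNat hF hΛ (integrable_sq_poissonMeasure _)
  simpa only [pointCount_eq_card (hfin _), ENat.toNat_natCast] using this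

theorem IsPoissonPointProcess.integrable_card (h : IsPoissonPointProcess Φ Λ μ)
    {F : Set E} (hF : MeasurableSet F) (hΛ : Λ F ≠ ⊤) (hfin : ∀ ω, (Φ ω ∩ F).Finite) :
    Integrable (fun ω => ((pointsIn Φ F ω).card : ℝ)) μ := by
  have := h.integrable_comp_toNat hF hΛ (integrable_id_poissonMeasure _)
  simpa only [pointCount_eq_card (hfin _), ENat.toNat_natCast] using this

/-- Characteristic functional and exponentially weighted Campbell formula of a Poisson process. -/
theorem IsPoissonPointProcess.campbell (h : IsPoissonPointProcess Φ Λ μ) [IsFiniteMeasure μ]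
    {F : Set E} (hF : MeasurableSet F) (hΛ : Λ F ≠ ⊤) (hfin : ∀ ω, (Φ ω ∩ F).Finite)
    {f : E → ℝ} {g : E → ℂ} (hf : Measurable f) (hg : Measurable g) {c : ℝ}
    (hfc : ∀ x, |f x| ≤ c) (hgc : ∀ x, ‖g x‖ ≤ c) :
    ∫ ω, Complex.exp (Complex.I * (∑ p ∈ pointsIn Φ F ω, f p : ℝ)) ∂μ
      = Complex.exp (∫ x in F, (Complex.exp (Complex.I * f x) - 1) ∂Λ) ∧
    ∫ ω, (∑ p ∈ pointsIn Φ F ω, g p) *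
        Complex.exp (Complex.I * (∑ p ∈ pointsIn Φ F ω, f p : ℝ)) ∂μ
      = (∫ x in F, g x * Complex.exp (Complex.I * f x) ∂Λ) *
        ∫ ω, Complex.exp (Complex.I * (∑ p ∈ pointsIn Φ F ω, f p : ℝ)) ∂μ := by
  have hfinm : IsFiniteMeasure (Λ.restrict F) := ⟨by
    rw [Measure.restrict_apply_univ]; exact hΛ.lt_top⟩
  -- The pair is approximated jointly, so that one simple function serves both the exponent and the
  -- summand; the bound c, preserved by the approximation, provides the dominating functions.
  have hq : StronglyMeasurable fun x => (f x, g x) := (hf.prodMk hg).stronglyMeasurable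
  have hqc : ∀ x, ‖(f x, g x)‖ ≤ c := fun x => by
    rw [Prod.norm_mk]; exact max_le (hfc x) (hgc x)
  set s : ℕ → SimpleFunc E (ℝ × ℂ) := fun n => hq.approxBounded c n with hs
  have hc : ∀ x : E, 0 ≤ c := fun x => (abs_nonneg _).trans (hfc x)
  have hsc : ∀ n x, ‖s n x‖ ≤ c := fun n x => hq.norm_approxBounded_le (hc x) n x
  have hs2 : ∀ n x, ‖(s n x).2‖ ≤ c := fun n x => (norm_snd_le _).trans (hsc n x)
  have hlim : ∀ x, Tendsto (fun n => s n x) atTop (𝓝 (f x, g x)) := fun x =>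
    hq.tendsto_approxBounded_of_norm_le (hqc x)
  have hlim1 : ∀ x, Tendsto (fun n => (s n x).1) atTop (𝓝 (f x)) := fun x =>
    (continuous_fst.tendsto _).comp (hlim x)
  have hlim2 : ∀ x, Tendsto (fun n => (s n x).2) atTop (𝓝 (g x)) := fun x =>
    (continuous_snd.tendsto _).comp (hlim x)
  have hnexp : ∀ r : ℝ, ‖Complex.exp (Complex.I * r)‖ = 1 := fun r => by
    rw [mul_comm]; exact Complex.norm_exp_ofReal_mul_I r
  have hexpc : Continuous fun r : ℝ => Complex.exp (Complex.I * r) := by fun_prop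
  have hm1 : ∀ n, Measurable fun ω => ∑ p ∈ pointsIn Φ F ω, (s n p).1 := fun n =>
    (measurable_sum_pointsIn hF hfin
      (measurable_fst.comp (s n).measurable).stronglyMeasurable).mono (pointProcessSigma_le h) le_rfl
  have hm2 : ∀ n, Measurable fun ω => ∑ p ∈ pointsIn Φ F ω, (s n p).2 := fun n =>
    (measurable_sum_pointsIn hF hfin
      (measurable_snd.comp (s n).measurable).stronglyMeasurable).mono (pointProcessSigma_le h) le_rfl
  have hcard := h.integrable_card hF hΛ hfin
  have hA : ∀ ω, Tendsto (fun n => Complex.exp (Complex.I * (∑ p ∈ pointsIn Φ F ω, (s n p).1 : ℝ)))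
      atTop (𝓝 (Complex.exp (Complex.I * (∑ p ∈ pointsIn Φ F ω, f p : ℝ)))) := fun ω =>
    (hexpc.tendsto _).comp (tendsto_finsetSum _ fun p _ => hlim1 p)
  have hB : ∀ x, Tendsto (fun n => Complex.exp (Complex.I * (s n x).1)) atTop
      (𝓝 (Complex.exp (Complex.I * f x))) := fun x => (hexpc.tendsto _).comp (hlim1 x)
  have hBm : ∀ n, Measurable fun x => Complex.exp (Complex.I * (s n x).1) := fun n =>
    hexpc.measurable.comp (measurable_fst.comp (s n).measurable)
  have hL1 : Tendsto (fun n => ∫ ω, Complex.exp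
      (Complex.I * (∑ p ∈ pointsIn Φ F ω, (s n p).1 : ℝ)) ∂μ) atTop
      (𝓝 (∫ ω, Complex.exp (Complex.I * (∑ p ∈ pointsIn Φ F ω, f p : ℝ)) ∂μ)) :=
    tendsto_integral_of_dominated_convergence (fun _ => 1)
      (fun n => (hexpc.measurable.comp (hm1 n)).aestronglyMeasurable) (integrable_const _)
      (fun n => Eventually.of_forall fun ω => (hnexp _).le) (Eventually.of_forall hA)
  have hL2 : Tendsto (fun n => ∫ ω, (∑ p ∈ pointsIn Φ F ω, (s n p).2) * Complex.exp
      (Complex.I * (∑ p ∈ pointsIn Φ F ω, (s n p).1 : ℝ)) ∂μ) atTop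
      (𝓝 (∫ ω, (∑ p ∈ pointsIn Φ F ω, g p) *
        Complex.exp (Complex.I * (∑ p ∈ pointsIn Φ F ω, f p : ℝ)) ∂μ)) := by
    refine tendsto_integral_of_dominated_convergence (fun ω => (pointsIn Φ F ω).card * c)
      (fun n => ((hm2 n).mul (hexpc.measurable.comp (hm1 n))).aestronglyMeasurable)
      (hcard.mul_const c) (fun n => Eventually.of_forall fun ω => ?_)
      (Eventually.of_forall fun ω =>
        (tendsto_finsetSum _ fun p _ => hlim2 p).mul (hA ω))
    rw [norm_mul, hnexp, mul_one]
    exact (norm_sum_le_of_le _ fun p _ => hs2 n p).trans (by simp)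
  have hR1 : Tendsto (fun n => ∫ x in F, (Complex.exp (Complex.I * (s n x).1) - 1) ∂Λ) atTop
      (𝓝 (∫ x in F, (Complex.exp (Complex.I * f x) - 1) ∂Λ)) := by
    refine tendsto_integral_of_dominated_convergence (fun _ => 2)
      (fun n => ((hBm n).sub_const 1).aestronglyMeasurable) (integrable_const _)
      (fun n => Eventually.of_forall fun x => ?_)
      (Eventually.of_forall fun x => (hB x).sub_const 1)
    refine (norm_sub_le _ _).trans ?_
    rw [hnexp, norm_one]; norm_num
  have hR2 : Tendsto (fun n => ∫ x in F, (s n x).2 * Complex.exp (Complex.I * (s n x).1) ∂Λ) atTop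
      (𝓝 (∫ x in F, g x * Complex.exp (Complex.I * f x) ∂Λ)) := by
    refine tendsto_integral_of_dominated_convergence (fun _ => c)
      (fun n => ((measurable_snd.comp (s n).measurable).mul (hBm n)).aestronglyMeasurable)
      (integrable_const _) (fun n => Eventually.of_forall fun x => ?_)
      (Eventually.of_forall fun x => (hlim2 x).mul (hB x))
    rw [norm_mul, hnexp, mul_one]
    exact hs2 n x
  have hsimple := fun n => h.campbell_simpleFunc hF hΛ hfin (s n)
  have hR3 := (Complex.continuous_exp.tendsto _).comp hR1
  have hfirst := tendsto_nhds_unique hL1 (hR3.congr fun n => (hsimple n).1.symm)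
  refine ⟨hfirst, ?_⟩
  rw [hfirst]
  exact tendsto_nhds_unique hL2 ((hR2.mul hR3).congr fun n => (hsimple n).2.symm)

end Campbell

/-! ### Geometry of the image regions. -/

section ImageRegions

/-- The squares of order k are thus centred, up to translation, on the points of the lattice 2aℤ² at
scaled ℓ¹-distance k from the origin, so different orders use different lattice points. -/
theorem exists_int_of_mem_imageDirections {k : ℕ} {g : Plane} (hg : g ∈ imageDirections k) :
    ∃ m : Fin 2 → ℤ, |m 0| + |m 1| = k ∧ ∀ i, (k : ℝ) * g i = m i := by
  rw [imageDirections] at hg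
  split_ifs at hg with hk
  · refine ⟨0, by simp [hk], fun i => by simp [hk]⟩
  · obtain ⟨k₁, k₂, hsum, h0, h1⟩ := hg
    have hk' : (k : ℝ) ≠ 0 := by exact_mod_cast hk
    have key : ∀ (r : ℝ) (j : ℕ), |r| = (j : ℝ) / k → ∃ m : ℤ, |m| = j ∧ (k : ℝ) * r = m := by
      intro r j hr
      rcases abs_cases r with ⟨h, -⟩ | ⟨h, -⟩
      · exact ⟨j, by simp, by rw [← h, hr]; field_simp; simp⟩
      · refine ⟨-j, by simp, ?_⟩
        have : r = -((j : ℝ) / k) := by rw [← hr, h, neg_neg]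
        rw [this]; field_simp; simp
    obtain ⟨m₀, h2, h3⟩ := key _ _ h0
    obtain ⟨m₁, h4, h5⟩ := key _ _ h1
    refine ⟨![m₀, m₁], ?_, fun i => ?_⟩
    · simp [h2, h4, ← hsum]
    · fin_cases i
      · simpa using h3
      · simpa using h5

theorem mem_imageRegion {k : ℕ} {c x : Plane} {a : ℝ} :
    x ∈ imageRegion k c a ↔
      ∃ g ∈ imageDirections k, ∀ i, |x i - c i - 2 * k * a * g i| ≤ a := by
  rw [imageRegion, Set.mem_add]
  constructor
  · rintro ⟨s, hs, _, ⟨g, hg, rfl⟩, rfl⟩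
    refine ⟨g, hg, fun i => ?_⟩
    convert hs i using 2
    simp
    ring
  · rintro ⟨g, hg, h⟩
    refine ⟨x - (2 * (k : ℝ) * a) • g, fun i => ?_, _, Set.smul_mem_smul_set hg, sub_add_cancel _ _⟩
    convert h i using 2
    simp
    ring

theorem mem_imageRegion_neg {k : ℕ} {y z : Plane} {a : ℝ} :
    z ∈ imageRegion k (-y) a ↔ z + y ∈ imageRegion k 0 a := by
  simp [mem_imageRegion]

theorem isCompact_square (c : Plane) (a : ℝ) : IsCompact (square c a) := by
  have hcl : IsClosed (square c a) := by
    have : square c a = ⋂ i, {x : Plane | |x i - c i| ≤ a} := by ext; simp [square]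
    rw [this]
    exact isClosed_iInter fun i => isClosed_le (by fun_prop) continuous_const
  refine Metric.isCompact_of_isClosed_isBounded hcl ?_
  have hsub : square c a ⊆ WithLp.ofLp ⁻¹' (Set.univ.pi fun i => Set.Icc (c i - a) (c i + a)) := by
    intro x hx i _
    have := abs_le.mp (hx i)
    exact ⟨by linarith, by linarith⟩
  refine Bornology.IsBounded.subset ?_ hsub
  exact ((PiLp.antilipschitzWith_ofLp 2 (fun _ : Fin 2 => ℝ)).isBounded_preimage
    (isCompact_univ_pi fun i => isCompact_Icc).isBounded)

theorem isCompact_imageDirections (k : ℕ) : IsCompact (imageDirections k) := by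
  rw [imageDirections]
  split_ifs with hk
  · exact isCompact_singleton
  · have hset : {g : Plane | ∃ k₁ k₂ : ℕ, k₁ + k₂ = k ∧ |g 0| = (k₁ : ℝ) / k ∧ |g 1| = (k₂ : ℝ) / k}
        = ⋃ j ∈ Finset.range (k + 1),
          {g : Plane | |g 0| = (j : ℝ) / k ∧ |g 1| = ((k - j : ℕ) : ℝ) / k} := by
      ext g
      simp only [Set.mem_ofPred_eq, Set.mem_iUnion, Finset.mem_range, exists_prop]
      constructor
      · rintro ⟨k₁, k₂, rfl, h0, h1⟩
        exact ⟨k₁, by omega, h0, by rwa [Nat.add_sub_cancel_left]⟩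
      · rintro ⟨j, hj, h0, h1⟩
        exact ⟨j, k - j, by omega, h0, h1⟩
    rw [hset]
    refine Metric.isCompact_of_isClosed_isBounded ?_ ?_
    · refine isClosed_biUnion_finset fun j _ => IsClosed.inter ?_ ?_
      · exact isClosed_eq (by fun_prop) continuous_const
      · exact isClosed_eq (by fun_prop) continuous_const
    · refine (isCompact_square 0 1).isBounded.subset ?_
      rw [← hset]
      rintro g ⟨k₁, k₂, hsum, h0, h1⟩ i
      have hk' : (0 : ℝ) < k := by exact_mod_cast Nat.pos_of_ne_zero hk
      fin_cases i
      · simp only [PiLp.zero_apply, sub_zero]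
        have hle : k₁ ≤ k := by omega
        exact h0.le.trans (div_le_one_of_le₀ (Nat.cast_le.mpr hle) hk'.le)
      · simp only [PiLp.zero_apply, sub_zero]
        have hle : k₂ ≤ k := by omega
        exact h1.le.trans (div_le_one_of_le₀ (Nat.cast_le.mpr hle) hk'.le)

theorem isCompact_imageRegion (k : ℕ) (c : Plane) (a : ℝ) : IsCompact (imageRegion k c a) :=
  (isCompact_square c a).add ((isCompact_imageDirections k).smul _)

theorem measurableSet_imageRegion (k : ℕ) (c : Plane) (a : ℝ) :
    MeasurableSet (imageRegion k c a) :=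
  (isCompact_imageRegion k c a).measurableSet

theorem volume_coordinate_eq (i : Fin 2) (r : ℝ) : volume {x : Plane | x i = r} = 0 := by
  have h := (PiLp.volume_preserving_ofLp (Fin 2)).measure_preimage
    (s := {x : Fin 2 → ℝ | x i = r})
    (measurableSet_eq_fun (measurable_pi_apply i) measurable_const).nullMeasurableSet
  have h2 : volume {x : Fin 2 → ℝ | x i = r} = 0 := by
    rw [volume_pi]
    exact Measure.pi_hyperplane (α := fun _ : Fin 2 => ℝ) (fun _ => volume) i r
  rw [h2] at h
  exact h

/-- Squares of different orders have distinct centres, which differ in some coordinate by at least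
their side 2a. They can meet only on a line where that coordinate is fixed, and countably many lines
are null. -/
theorem volume_imageRegion_inter {k l : ℕ} (hkl : k ≠ l) (c : Plane) {a : ℝ} (ha : 0 < a) :
    volume (imageRegion k c a ∩ imageRegion l c a) = 0 := by
  have hsub : imageRegion k c a ∩ imageRegion l c a ⊆
      ⋃ (i : Fin 2) (n : ℤ), {x : Plane | x i = c i + a * n} := by
    rintro x ⟨hx, hx'⟩
    obtain ⟨g, hg, h⟩ := mem_imageRegion.mp hx
    obtain ⟨g', hg', h'⟩ := mem_imageRegion.mp hx'
    obtain ⟨m, hm, hmg⟩ := exists_int_of_mem_imageDirections hg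
    obtain ⟨m', hm', hmg'⟩ := exists_int_of_mem_imageDirections hg'
    have hne : ∃ i, m i ≠ m' i := by
      by_contra! hcon
      rw [hcon 0, hcon 1, hm'] at hm
      exact hkl (by exact_mod_cast hm.symm)
    obtain ⟨i, hi⟩ := hne
    have e1 := abs_le.mp (h i)
    have e2 := abs_le.mp (h' i)
    have f1 : 2 * (k : ℝ) * a * g i = 2 * a * m i := by rw [← hmg]; ring
    have f2 : 2 * (l : ℝ) * a * g' i = 2 * a * m' i := by rw [← hmg']; ring
    rw [f1] at e1
    rw [f2] at e2
    simp only [Set.mem_iUnion, Set.mem_ofPred_eq]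
    -- If the closed intervals of radius a about 2a·m and 2a·m′ meet with m ≠ m′, they share just
    -- the endpoint a(m + m′).
    refine ⟨i, m i + m' i, ?_⟩
    push_cast
    rcases lt_or_gt_of_ne hi with hlt | hlt
    · have : (m i : ℝ) + 1 ≤ m' i := by exact_mod_cast hlt
      have := mul_le_mul_of_nonneg_left this ha.le
      linarith
    · have : (m' i : ℝ) + 1 ≤ m i := by exact_mod_cast hlt
      have := mul_le_mul_of_nonneg_left this ha.le
      linarith
  refine measure_mono_null hsub ?_
  simp only [measure_iUnion_null_iff]
  exact fun i n => volume_coordinate_eq i _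

end ImageRegions

/-! ### Independent Poisson processes together. -/

section Superposition

variable {Ω E κ : Type*} [mΩ : MeasurableSpace Ω] [MeasurableSpace E] [TopologicalSpace E]
  [Fintype κ] {μ : Measure Ω} {Φ : κ → Ω → Set E} {Λ : κ → Measure E}

/-- The exponentially weighted Campbell formula for finitely many independent Poisson processes. -/
theorem campbell_superposition [IsFiniteMeasure μ] (h : ∀ k, IsPoissonPointProcess (Φ k) (Λ k) μ)
    (hindep : iIndep (fun k => pointProcessSigma (Φ k)) μ)
    {F : κ → Set E} (hF : ∀ k, MeasurableSet (F k)) (hΛ : ∀ k, Λ k (F k) ≠ ⊤)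
    (hfin : ∀ k ω, (Φ k ω ∩ F k).Finite)
    {f : κ → E → ℝ} {g : κ → E → ℂ} (hf : ∀ k, Measurable (f k)) (hg : ∀ k, Measurable (g k))
    {c : ℝ} (hfc : ∀ k x, |f k x| ≤ c) (hgc : ∀ k x, ‖g k x‖ ≤ c) :
    ∫ ω, (∑ k, ∑ p ∈ pointsIn (Φ k) (F k) ω, g k p) *
        Complex.exp (Complex.I * (∑ k, ∑ p ∈ pointsIn (Φ k) (F k) ω, f k p : ℝ)) ∂μ
      = (∑ k, ∫ x in F k, g k x * Complex.exp (Complex.I * f k x) ∂(Λ k)) *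
        ∏ k, Complex.exp (∫ x in F k, (Complex.exp (Complex.I * f k x) - 1) ∂(Λ k)) := by
  have hcamp := fun k => (h k).campbell (hF k) (hΛ k) (hfin k) (hf k) (hg k) (hfc k) (hgc k)
  set U : κ → Ω → ℂ := fun k ω => ∑ p ∈ pointsIn (Φ k) (F k) ω, g k p with hU
  set V : κ → Ω → ℂ := fun k ω =>
    Complex.exp (Complex.I * (∑ p ∈ pointsIn (Φ k) (F k) ω, f k p : ℝ)) with hV
  have hUm : ∀ k, Measurable[pointProcessSigma (Φ k)] (U k) := fun k =>
    measurable_sum_pointsIn (hF k) (hfin k) (hg k).stronglyMeasurable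
  have hVm : ∀ k, Measurable[pointProcessSigma (Φ k)] (V k) := fun k =>
    (by fun_prop : Measurable fun r : ℝ => Complex.exp (Complex.I * r)).comp
      (measurable_sum_pointsIn (hF k) (hfin k) (hf k).stronglyMeasurable)
  have hind : iIndepFun (fun k ω => (U k ω, V k ω)) μ :=
    iIndep_of_iIndep_of_le hindep fun k => ((hUm k).prodMk (hVm k)).comap_le
  have hUint : ∀ k, Integrable (U k) μ := fun k => by
    refine (((h k).integrable_card (hF k) (hΛ k) (hfin k)).mul_const c).mono'
      ((hUm k).mono (pointProcessSigma_le (h k)) le_rfl).aestronglyMeasurable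
      (Filter.Eventually.of_forall fun ω => ?_)
    exact (norm_sum_le_of_le _ fun p _ => hgc k p).trans (by simp)
  have key := (iIndepFun.integral_sum_mul_prod hind hUint
    (fun k => (hUm k).mono (pointProcessSigma_le (h k)) le_rfl)
    (fun k => (hVm k).mono (pointProcessSigma_le (h k)) le_rfl)
    (fun k ω => by simp only [hV]; rw [mul_comm, Complex.norm_exp_ofReal_mul_I])
    (fun k => (hcamp k).2)).2
  have hprod : ∀ ω, Complex.exp (Complex.I * (∑ k, ∑ p ∈ pointsIn (Φ k) (F k) ω, f k p : ℝ))
      = ∏ k, V k ω := by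
    intro ω
    rw [Complex.ofReal_sum, Finset.mul_sum, Complex.exp_sum]
  simp only [hprod]
  rw [key]
  congr 1
  exact Finset.prod_congr rfl fun k _ => (hcamp k).1

/-- The number of points outside `F k` is Poisson with parameter 0, hence almost surely zero.
Confinement to the regions is available only in this almost sure sense. -/
theorem ae_subset_of_compl_null (h : ∀ k, IsPoissonPointProcess (Φ k) (Λ k) μ)
    {F : κ → Set E} (hF : ∀ k, MeasurableSet (F k)) (hΛ : ∀ k, Λ k (F k)ᶜ = 0) :
    ∀ᵐ ω ∂μ, ∀ k, Φ k ω ⊆ F k := by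
  rw [ae_all_iff]
  intro k
  have hm := (h k).measurable_count _ (hF k).compl
  have hlaw := (h k).count_law _ (hF k).compl (by simp [hΛ k])
  have h0 : μ.map (pointCount (Φ k) (F k)ᶜ) {0}ᶜ = 0 := by
    rw [hlaw, hΛ k, Measure.map_apply Measurable.of_discrete (measurableSet_singleton _).compl]
    have : (fun n : ℕ => (n : ℕ∞)) ⁻¹' {0}ᶜ = {0}ᶜ := by ext n; simp
    rw [this, ENNReal.toNNReal_zero, prob_compl_eq_zero_iff (measurableSet_singleton _),
      poissonMeasure_singleton]
    simp
  rw [Measure.map_apply hm (measurableSet_singleton _).compl] at h0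
  filter_upwards [measure_eq_zero_iff_ae_notMem.mp h0] with ω hω
  have h1 : pointCount (Φ k) (F k)ᶜ ω = 0 := by simpa using hω
  rw [pointCount, Set.encard_eq_zero, ← Set.disjoint_iff_inter_eq_empty,
    Set.disjoint_compl_right_iff_subset] at h1
  exact h1

end Superposition

/-! ### The serving regions and the decay of F_M. -/

section ServingRegion

open Filter

theorem measurableSet_servingRegion (a h β η σ τ : ℝ) (k : ℕ) (y : Plane) :
    MeasurableSet (servingRegion a h β η σ τ k y) :=
  (measurableSet_imageRegion k (-y) a).inter measurableSet_ball

theorem lt_radiusD {h β η σ τ ρ : ℝ} (hh : 0 < h) (hβ : 0 < β) (hη : 0 ≤ η) (hσ : 0 < σ)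
    (hτ : 0 < τ) {k : ℕ} (hρ : 0 ≤ ρ) (hlt : τ * σ ^ 2 < η ^ k * (ρ ^ 2 + h ^ 2) ^ (-β)) :
    ρ < radiusD h β η σ τ k := by
  have hs : 0 < ρ ^ 2 + h ^ 2 := by positivity
  have hts : 0 < τ * σ ^ 2 := by positivity
  rw [radiusD, Real.lt_sqrt hρ, lt_sub_iff_add_lt]
  rw [Real.rpow_neg hs.le, ← div_eq_mul_inv, lt_div_iff₀ (Real.rpow_pos_of_pos hs _),
    mul_comm, ← lt_div_iff₀ hts] at hlt
  have h1 := Real.rpow_lt_rpow (by positivity) hlt (by positivity : 0 < 1 / β)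
  rw [← Real.rpow_mul hs.le, mul_one_div, div_self hβ.ne', Real.rpow_one,
    Real.div_rpow (by positivity) hts.le, ← Real.rpow_natCast η, ← Real.rpow_mul hη,
    mul_one_div] at h1
  rwa [neg_div, Real.rpow_neg hts.le, ← div_eq_mul_inv]

theorem integrable_sq_norm_transformF_term {a h β η σ τ : ℝ} (hh : 0 < h) (hβ : 0 < β)
    (hη : 0 ≤ η) (hτ : 0 < τ) (k : ℕ) (y : Plane) :
    Integrable fun t : ℝ => ‖∫ x in servingRegion a h β η σ τ k y,
      Complex.exp (-(Complex.I * t / τ) * ((η ^ k * (‖x‖ ^ 2 + h ^ 2) ^ (-β) : ℝ) : ℂ))‖ ^ 2 := by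
  rcases le_or_gt (radiusD h β η σ τ k) 0 with hR | hR
  · have : servingRegion a h β η σ τ k y = ∅ := by
      rw [servingRegion, Metric.ball_eq_empty.mpr hR, Set.inter_empty]
    simp [this]
  · have hw : 0 < η ^ k := by
      refine lt_of_le_of_ne (by positivity) fun h0 => ?_
      obtain ⟨h1, h2⟩ := pow_eq_zero_iff'.mp h0.symm
      have hne : (k : ℝ) / β ≠ 0 := div_ne_zero (by exact_mod_cast h2) hβ.ne'
      rw [radiusD, h1, Real.zero_rpow hne, zero_mul, zero_sub, Real.sqrt_eq_zero_of_nonpos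
        (by nlinarith)] at hR
      exact lt_irrefl _ hR
    have := (integrable_sq_norm_setIntegral_exp_pathloss hw hh hβ hR
      (Set.inter_subset_right : servingRegion a h β η σ τ k y ⊆ _)).comp_div hτ.ne'
    refine this.congr (Eventually.of_forall fun t => ?_)
    simp only [Complex.ofReal_div, mul_div_assoc]
    rfl

theorem setIntegral_imageRegion_sub (k : ℕ) (a : ℝ) (y : Plane) (u : Plane → ℂ) :
    ∫ x in imageRegion k 0 a, u (x - y) = ∫ z in imageRegion k (-y) a, u z := by
  rw [← integral_indicator (measurableSet_imageRegion _ _ _),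
    ← integral_indicator (measurableSet_imageRegion _ _ _),
    ← integral_sub_right_eq_self ((imageRegion k (-y) a).indicator u) y]
  congr 1
  ext x
  have : x ∈ imageRegion k 0 a ↔ x - y ∈ imageRegion k (-y) a := by
    rw [mem_imageRegion_neg, sub_add_cancel]
  by_cases hx : x ∈ imageRegion k 0 a
  · rw [Set.indicator_of_mem hx, Set.indicator_of_mem (this.mp hx)]
  · rw [Set.indicator_of_notMem hx, Set.indicator_of_notMem (this.not.mp hx)]

theorem volume_real_iUnion_servingRegion (K : ℕ) {a : ℝ} (ha : 0 < a) (h β η σ τ : ℝ) (y : Plane) :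
    volume.real (⋃ k ∈ Finset.range (K + 1), servingRegion a h β η σ τ k y)
      = ∑ k ∈ Finset.range (K + 1), volume.real (servingRegion a h β η σ τ k y) := by
  have hdisj : Set.Pairwise (Finset.range (K + 1) : Set ℕ)
      (Function.onFun (AEDisjoint (volume : Measure Plane)) fun k =>
        servingRegion a h β η σ τ k y) := fun k _ l _ hkl =>
    measure_mono_null (Set.inter_subset_inter Set.inter_subset_left Set.inter_subset_left)
      (volume_imageRegion_inter hkl (-y) ha)
  rw [measureReal_def, measure_biUnion_finset₀ hdisj
    fun k _ => (measurableSet_servingRegion _ _ _ _ _ _ _ _).nullMeasurableSet,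
    ENNReal.toReal_sum fun k _ => ?_]
  · rfl
  · exact ((measure_mono Set.inter_subset_right).trans_lt measure_ball_lt_top).ne

end ServingRegion

/-! ### Margins of the serving points and their exponential sum. -/

section Coverage

open Filter

variable {Ω : Type*} {K : ℕ}

/-- The transmitters located in the image regions, as a finite set. -/
noncomputable def roomPoints (a : ℝ) (Φ : Fin (K + 1) → Ω → Set Plane) (ω : Ω) :
    Finset (Fin (K + 1) × Plane) :=
  (Finset.univ.sigma fun k : Fin (K + 1) => pointsIn (Φ k) (imageRegion k 0 a) ω).map
    (Equiv.sigmaEquivProd _ _).toEmbedding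

theorem sum_roomPoints {G : Type*} [AddCommMonoid G] (a : ℝ) (Φ : Fin (K + 1) → Ω → Set Plane)
    (ω : Ω) (u : Fin (K + 1) × Plane → G) :
    ∑ p ∈ roomPoints a Φ ω, u p
      = ∑ k, ∑ x ∈ pointsIn (Φ k) (imageRegion k 0 a) ω, u (k, x) := by
  rw [roomPoints, Finset.sum_map, Finset.sum_sigma]
  rfl

theorem mem_roomPoints {a : ℝ} {Φ : Fin (K + 1) → Ω → Set Plane} {ω : Ω}
    (hfin : ∀ k : Fin (K + 1), (Φ k ω ∩ imageRegion k 0 a).Finite) {p : Fin (K + 1) × Plane} :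
    p ∈ roomPoints a Φ ω ↔ p ∈ transmitters Φ ω ∧ p.2 ∈ imageRegion p.1 0 a := by
  rw [transmitters, Set.mem_ofPred_eq, ← mem_pointsIn (hfin p.1), roomPoints, Finset.mem_map_equiv,
    Finset.mem_sigma]
  simp

/-- The total power received at `y` from the transmitters in the image regions. -/
noncomputable def totalPower (a h β η : ℝ) (y : Plane) (Φ : Fin (K + 1) → Ω → Set Plane)
    (ω : Ω) : ℝ :=
  ∑ p ∈ roomPoints a Φ ω, rxPower h β η y p

/-- The interference plus noise of `p` minus `1 / τ` times its power: negative exactly if the SINR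
of `p` exceeds `τ`. -/
noncomputable def sinrMargin (a h β η σ τ : ℝ) (y : Plane) (Φ : Fin (K + 1) → Ω → Set Plane)
    (ω : Ω) (p : Fin (K + 1) × Plane) : ℝ :=
  totalPower a h β η y Φ ω + σ ^ 2 - (1 + 1 / τ) * rxPower h β η y p

open scoped Classical in
/-- The transmitters in the serving regions. -/
noncomputable def servingPoints (a h β η σ τ : ℝ) (y : Plane) (Φ : Fin (K + 1) → Ω → Set Plane)
    (ω : Ω) : Finset (Fin (K + 1) × Plane) :=
  (roomPoints a Φ ω).filter fun p => p.2 - y ∈ servingRegion a h β η σ τ p.1 y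

theorem card_servingPoints_le (a h β η σ τ : ℝ) (y : Plane) (Φ : Fin (K + 1) → Ω → Set Plane)
    (ω : Ω) : (servingPoints a h β η σ τ y Φ ω).card ≤ (roomPoints a Φ ω).card := by
  classical
  exact Finset.card_le_card (Finset.filter_subset _ _)

theorem rxPower_nonneg {h β η : ℝ} (hη : 0 ≤ η) (y : Plane) (p : Fin (K + 1) × Plane) :
    0 ≤ rxPower h β η y p := by
  unfold rxPower; positivity

theorem exists_rxPower_le {h β η : ℝ} (hh : 0 < h) (hβ : 0 < β) (hη : 0 ≤ η) (y : Plane) :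
    ∃ M, 0 ≤ M ∧ ∀ p : Fin (K + 1) × Plane, rxPower h β η y p ≤ M := by
  refine ⟨(∑ k : Fin (K + 1), η ^ (k : ℕ)) * (h ^ 2) ^ (-β), by positivity, fun p => ?_⟩
  unfold rxPower
  have h1 : η ^ (p.1 : ℕ) ≤ ∑ k : Fin (K + 1), η ^ (k : ℕ) :=
    Finset.single_le_sum (f := fun k : Fin (K + 1) => η ^ (k : ℕ)) (fun k _ => by positivity)
      (Finset.mem_univ p.1)
  have h2 : (‖p.2 - y‖ ^ 2 + h ^ 2) ^ (-β) ≤ (h ^ 2) ^ (-β) :=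
    Real.rpow_le_rpow_of_nonpos (by positivity) (by nlinarith [sq_nonneg ‖p.2 - y‖]) (by linarith)
  gcongr

theorem measurable_rxPower (h β η : ℝ) (y : Plane) (k : Fin (K + 1)) :
    Measurable fun x => rxPower h β η y (k, x) := by
  unfold rxPower; fun_prop

/-- The weight of a transmitter in the exponential sum over the margins. -/
noncomputable def servingWeight (a h β η σ τ : ℝ) (y : Plane) (t : ℝ) (k : Fin (K + 1))
    (x : Plane) : ℂ :=
  ((· - y) ⁻¹' servingRegion a h β η σ τ k y).indicator
    (fun x => Complex.exp (Complex.I * (-(t * ((1 + 1 / τ) * rxPower h β η y (k, x))) : ℝ))) x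

theorem measurable_servingWeight (a h β η σ τ : ℝ) (y : Plane) (t : ℝ) (k : Fin (K + 1)) :
    Measurable (servingWeight a h β η σ τ y t k) := by
  have := measurable_rxPower h β η y k
  exact Measurable.indicator (by fun_prop)
    ((measurable_id.sub_const y) (measurableSet_servingRegion a h β η σ τ k y))

theorem norm_servingWeight_le (a h β η σ τ : ℝ) (y : Plane) (t : ℝ) (k : Fin (K + 1))
    (x : Plane) : ‖servingWeight a h β η σ τ y t k x‖ ≤ 1 := by
  refine (norm_indicator_le_norm_self _ _).trans (le_of_eq ?_)
  rw [mul_comm, Complex.norm_exp_ofReal_mul_I]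

/-- Each margin depends on the whole configuration, but only through the total power, which is the
same for all points. Pulling it out leaves a weight depending on the single point, the shape that
Campbell's formula needs. -/
theorem expSum_servingPoints (a h β η σ τ : ℝ) (y : Plane) (Φ : Fin (K + 1) → Ω → Set Plane)
    (ω : Ω) (t : ℝ) :
    expSum (servingPoints a h β η σ τ y Φ ω) (sinrMargin a h β η σ τ y Φ ω) t
      = Complex.exp (Complex.I * t * (σ : ℂ) ^ 2) *
        ((∑ k, ∑ x ∈ pointsIn (Φ k) (imageRegion k 0 a) ω, servingWeight a h β η σ τ y t k x) *
          Complex.exp (Complex.I * (∑ k, ∑ x ∈ pointsIn (Φ k) (imageRegion k 0 a) ω,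
            t * rxPower h β η y (k, x) : ℝ))) := by
  classical
  rw [expSum, servingPoints, Finset.sum_filter, sum_roomPoints, Finset.sum_mul, Finset.mul_sum]
  refine Finset.sum_congr rfl fun k _ => ?_
  rw [Finset.sum_mul, Finset.mul_sum]
  refine Finset.sum_congr rfl fun x _ => ?_
  rw [servingWeight, Set.indicator_apply]
  simp only [Set.mem_preimage]
  split_ifs with hx
  · rw [← Complex.exp_add, ← Complex.exp_add, sinrMargin, totalPower, sum_roomPoints]
    congr 1
    simp only [← Finset.mul_sum]
    push_cast
    ring
  · simp

theorem expSum_servingPoints_zero (a h β η σ τ : ℝ) (y : Plane) (Φ : Fin (K + 1) → Ω → Set Plane)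
    (ω : Ω) :
    expSum (servingPoints a h β η σ τ y Φ ω) (sinrMargin a h β η σ τ y Φ ω) 0
      = (servingPoints a h β η σ τ y Φ ω).card := by
  simp [expSum]

/-! ### Means and integrability under the Poisson laws. -/

section Intensity

variable [MeasurableSpace Ω] {μ : Measure Ω}
  {lam a h β η σ τ : ℝ} {Φ : Fin (K + 1) → Ω → Set Plane} {y : Plane}

theorem finite_inter_imageRegion
    (hPPP : ∀ k : Fin (K + 1), IsPoissonPointProcess (Φ k)
      (ENNReal.ofReal lam • (volume : Measure Plane).restrict (imageRegion (k : ℕ) 0 a)) μ)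
    (k : Fin (K + 1)) (ω : Ω) : (Φ k ω ∩ imageRegion k 0 a).Finite :=
  (hPPP k).locallyFinite ω _ (isCompact_imageRegion _ _ _)

theorem intensity_imageRegion_ne_top (lam a : ℝ) (k : ℕ) :
    (ENNReal.ofReal lam • (volume : Measure Plane).restrict (imageRegion k 0 a))
      (imageRegion k 0 a) ≠ ⊤ := by
  rw [Measure.smul_apply, Measure.restrict_apply_self, smul_eq_mul]
  exact ENNReal.mul_ne_top ENNReal.ofReal_ne_top (isCompact_imageRegion k 0 a).measure_lt_top.ne

theorem integral_intensity (hlam : 0 ≤ lam) (k : ℕ) (u : Plane → ℂ) :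
    ∫ x in imageRegion k 0 a, u (x - y)
        ∂(ENNReal.ofReal lam • (volume : Measure Plane).restrict (imageRegion k 0 a))
      = lam * ∫ z in imageRegion k (-y) a, u z := by
  rw [Measure.restrict_smul, Measure.restrict_restrict_of_subset subset_rfl, integral_smul_measure,
    setIntegral_imageRegion_sub, ENNReal.toReal_ofReal hlam, Complex.real_smul]

/-- Campbell's formula returns the point's own share of the total power, so its coefficient becomes
−(1 + 1/τ) + 1 = −1/τ; this is the source of the argument it/τ of F_M. -/
theorem integral_servingWeight (hlam : 0 ≤ lam) (hτ : 0 < τ) (t : ℝ) (k : Fin (K + 1)) :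
    ∫ x in imageRegion k 0 a, servingWeight a h β η σ τ y t k x *
        Complex.exp (Complex.I * (t * rxPower h β η y (k, x) : ℝ))
        ∂(ENNReal.ofReal lam • (volume : Measure Plane).restrict (imageRegion k 0 a))
      = lam * ∫ x in servingRegion a h β η σ τ k y,
        Complex.exp (-(Complex.I * t / τ) *
          ((η ^ (k : ℕ) * (‖x‖ ^ 2 + h ^ 2) ^ (-β) : ℝ) : ℂ)) := by
  have hint := integral_intensity (a := a) (y := y) hlam k
    ((servingRegion a h β η σ τ k y).indicator fun x => Complex.exp (-(Complex.I * t / τ) *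
          ((η ^ (k : ℕ) * (‖x‖ ^ 2 + h ^ 2) ^ (-β) : ℝ) : ℂ)))
  have hsub : servingRegion a h β η σ τ k y ⊆ imageRegion k (-y) a := Set.inter_subset_left
  rw [setIntegral_indicator (measurableSet_servingRegion _ _ _ _ _ _ _ _),
    Set.inter_eq_self_of_subset_right hsub] at hint
  rw [← hint]
  congr 1
  ext x
  rw [servingWeight]
  by_cases hx : x - y ∈ servingRegion a h β η σ τ k y
  · have hx' : x ∈ (· - y) ⁻¹' servingRegion a h β η σ τ k y := hx
    rw [Set.indicator_of_mem hx', Set.indicator_of_mem hx,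
      ← Complex.exp_add, rxPower]
    congr 1
    have : (τ : ℂ) ≠ 0 := by exact_mod_cast hτ.ne'
    push_cast
    field_simp
    ring
  · have hx' : x ∉ (· - y) ⁻¹' servingRegion a h β η σ τ k y := hx
    rw [Set.indicator_of_notMem hx', Set.indicator_of_notMem hx,
      zero_mul]

theorem integral_exp_rxPower_sub_one (hlam : 0 ≤ lam) (t : ℝ) (k : Fin (K + 1)) :
    ∫ x in imageRegion k 0 a, (Complex.exp (Complex.I * (t * rxPower h β η y (k, x) : ℝ)) - 1)
        ∂(ENNReal.ofReal lam • (volume : Measure Plane).restrict (imageRegion k 0 a))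
      = -lam * ∫ z in imageRegion k (-y) a,
        (1 - Complex.exp (Complex.I * t * ((η ^ (k : ℕ) / (‖z‖ ^ 2 + h ^ 2) ^ β : ℝ) : ℂ))) := by
  have hint := integral_intensity (a := a) (y := y) hlam k
    (fun z => Complex.exp (Complex.I * t * ((η ^ (k : ℕ) / (‖z‖ ^ 2 + h ^ 2) ^ β : ℝ) : ℂ)) - 1)
  rw [neg_mul, ← mul_neg, ← integral_neg]
  simp only [neg_sub]
  rw [← hint]
  congr 1
  ext x
  rw [rxPower, Real.rpow_neg (by positivity), ← div_eq_mul_inv]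
  push_cast
  ring_nf

/-- The mean of the exponential sum over the margins of the serving points. -/
theorem integral_expSum_servingPoints [IsFiniteMeasure μ] (hlam : 0 ≤ lam) (hh : 0 < h) (hβ : 0 < β) (hη : 0 ≤ η)
    (hτ : 0 < τ)
    (hPPP : ∀ k : Fin (K + 1), IsPoissonPointProcess (Φ k)
      (ENNReal.ofReal lam • (volume : Measure Plane).restrict (imageRegion (k : ℕ) 0 a)) μ)
    (hindep : iIndep (fun k => pointProcessSigma (Φ k)) μ) (t : ℝ) :
    ∫ ω, expSum (servingPoints a h β η σ τ y Φ ω) (sinrMargin a h β η σ τ y Φ ω) t ∂μ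
      = lam * (Complex.exp (Complex.I * t * (σ : ℂ) ^ 2) *
        transformF K a h β η σ τ (Complex.I * t / τ) y *
        transformK K lam a h β η (Complex.I * t) y) := by
  obtain ⟨M, hM0, hM⟩ := exists_rxPower_le (K := K) hh hβ hη y
  simp only [expSum_servingPoints]
  rw [integral_const_mul, campbell_superposition hPPP hindep
    (fun k => measurableSet_imageRegion k 0 a) (fun k => intensity_imageRegion_ne_top lam a k)
    (finite_inter_imageRegion hPPP) (c := max (|t| * M) 1)
    (f := fun k x => t * rxPower h β η y (k, x))
    (fun k => (measurable_rxPower h β η y k).const_mul t)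
    (fun k => measurable_servingWeight a h β η σ τ y t k) (fun k x => le_max_of_le_left ?_)
    (fun k x => le_max_of_le_right (norm_servingWeight_le _ _ _ _ _ _ _ _ _ _))]
  · simp only [integral_servingWeight hlam hτ, integral_exp_rxPower_sub_one hlam]
    rw [← Complex.exp_sum, ← Finset.mul_sum, ← Finset.mul_sum, transformF, transformK,
      Finset.sum_range, Finset.sum_range]
    ring
  · rw [abs_mul, abs_of_nonneg (rxPower_nonneg hη y _)]
    exact mul_le_mul_of_nonneg_left (hM _) (abs_nonneg _)

theorem measurable_expSum_servingPoints
    (hPPP : ∀ k : Fin (K + 1), IsPoissonPointProcess (Φ k)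
      (ENNReal.ofReal lam • (volume : Measure Plane).restrict (imageRegion (k : ℕ) 0 a)) μ)
    (t : ℝ) :
    Measurable fun ω =>
      expSum (servingPoints a h β η σ τ y Φ ω) (sinrMargin a h β η σ τ y Φ ω) t := by
  simp only [expSum_servingPoints]
  have h1 : ∀ k, Measurable fun ω => ∑ x ∈ pointsIn (Φ k) (imageRegion k 0 a) ω,
      servingWeight a h β η σ τ y t k x := fun k =>
    (measurable_sum_pointsIn (measurableSet_imageRegion k 0 a) (finite_inter_imageRegion hPPP k)
      (measurable_servingWeight a h β η σ τ y t k).stronglyMeasurable).mono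
      (pointProcessSigma_le (hPPP k)) le_rfl
  have h2 : ∀ k, Measurable fun ω => ∑ x ∈ pointsIn (Φ k) (imageRegion k 0 a) ω,
      t * rxPower h β η y (k, x) := fun k =>
    (measurable_sum_pointsIn (measurableSet_imageRegion k 0 a) (finite_inter_imageRegion hPPP k)
      ((measurable_rxPower h β η y k).const_mul t).stronglyMeasurable).mono
      (pointProcessSigma_le (hPPP k)) le_rfl
  refine Measurable.const_mul ?_ _
  refine (Finset.measurable_fun_sum _ fun k _ => h1 k).mul ?_
  exact (by fun_prop : Measurable fun r : ℝ => Complex.exp (Complex.I * r)).comp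
    (Finset.measurable_fun_sum _ fun k _ => h2 k)

theorem integrable_card_sq_roomPoints
    (hPPP : ∀ k : Fin (K + 1), IsPoissonPointProcess (Φ k)
      (ENNReal.ofReal lam • (volume : Measure Plane).restrict (imageRegion (k : ℕ) 0 a)) μ) :
    Integrable (fun ω => ((roomPoints a Φ ω).card : ℝ)) μ ∧
    Integrable (fun ω => ((roomPoints a Φ ω).card : ℝ) ^ 2) μ := by
  have hcard : ∀ ω, ((roomPoints a Φ ω).card : ℝ)
      = ∑ k : Fin (K + 1), ((pointsIn (Φ k) (imageRegion k 0 a) ω).card : ℝ) := fun ω => by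
    have := sum_roomPoints a Φ ω (fun _ => (1 : ℝ))
    simpa using this
  have h1 : Integrable (fun ω => ((roomPoints a Φ ω).card : ℝ)) μ := by
    simp only [hcard]
    exact integrable_finsetSum _ fun k _ => (hPPP k).integrable_card
      (measurableSet_imageRegion k 0 a) (intensity_imageRegion_ne_top lam a k)
      (finite_inter_imageRegion hPPP k)
  refine ⟨h1, ?_⟩
  have h2 : Integrable (fun ω => ((K + 1 : ℕ) : ℝ) *
      ∑ k : Fin (K + 1), ((pointsIn (Φ k) (imageRegion k 0 a) ω).card : ℝ) ^ 2) μ :=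
    (integrable_finsetSum _ fun k _ => (hPPP k).integrable_card_sq
      (measurableSet_imageRegion k 0 a) (intensity_imageRegion_ne_top lam a k)
      (finite_inter_imageRegion hPPP k)).const_mul _
  refine h2.mono' (h1.aestronglyMeasurable.pow 2) (Eventually.of_forall fun ω => ?_)
  rw [Real.norm_of_nonneg (by positivity), hcard]
  refine (sq_sum_le_card_mul_sum_sq).trans (le_of_eq ?_)
  simp

/-- With N points in the regions there are at most N margins, each of size O(N + 1) because the
power is bounded (h > 0). Second moments of the counts therefore suffice. -/
theorem exists_integrable_bound_sinrMargin (hh : 0 < h) (hβ : 0 < β) (hη : 0 ≤ η) (hτ : 0 < τ)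
    (hPPP : ∀ k : Fin (K + 1), IsPoissonPointProcess (Φ k)
      (ENNReal.ofReal lam • (volume : Measure Plane).restrict (imageRegion (k : ℕ) 0 a)) μ) :
    ∃ W : Ω → ℝ, Integrable W μ ∧ ∀ ω, ∑ p ∈ servingPoints a h β η σ τ y Φ ω,
      |sinrMargin a h β η σ τ y Φ ω p| ≤ W ω := by
  obtain ⟨M, hM0, hM⟩ := exists_rxPower_le (K := K) hh hβ hη y
  obtain ⟨h1, h2⟩ := integrable_card_sq_roomPoints hPPP
  refine ⟨fun ω => M * ((roomPoints a Φ ω).card : ℝ) ^ 2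
    + (σ ^ 2 + (1 + 1 / τ) * M) * (roomPoints a Φ ω).card,
    (h2.const_mul _).add (h1.const_mul _), fun ω => ?_⟩
  set N : ℝ := ((roomPoints a Φ ω).card : ℝ) with hN
  have hI : totalPower a h β η y Φ ω ≤ N * M := by
    refine (Finset.sum_le_sum fun p _ => hM p).trans ?_
    simp [hN]
  have hI0 : 0 ≤ totalPower a h β η y Φ ω := Finset.sum_nonneg fun p _ => rxPower_nonneg hη y p
  have hX : ∀ p, |sinrMargin a h β η σ τ y Φ ω p| ≤ N * M + σ ^ 2 + (1 + 1 / τ) * M := by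
    intro p
    have hp0 := rxPower_nonneg (h := h) (β := β) hη y p
    have hτ' : 0 < 1 + 1 / τ := by positivity
    have h3 := mul_le_mul_of_nonneg_left (hM p) hτ'.le
    have h4 := mul_nonneg hτ'.le hp0
    rw [sinrMargin, abs_le]
    constructor <;> nlinarith [sq_nonneg σ]
  refine (Finset.sum_le_sum fun p _ => hX p).trans ?_
  rw [Finset.sum_const, nsmul_eq_mul]
  have hle : ((servingPoints a h β η σ τ y Φ ω).card : ℝ) ≤ N :=
    Nat.cast_le.mpr (card_servingPoints_le a h β η σ τ y Φ ω)
  have hpos : 0 ≤ N * M + σ ^ 2 + (1 + 1 / τ) * M := by positivity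
  refine (mul_le_mul_of_nonneg_right hle hpos).trans (le_of_eq ?_)
  ring

theorem integrable_card_servingPoints
    (hPPP : ∀ k : Fin (K + 1), IsPoissonPointProcess (Φ k)
      (ENNReal.ofReal lam • (volume : Measure Plane).restrict (imageRegion (k : ℕ) 0 a)) μ) :
    Integrable (fun ω => ((servingPoints a h β η σ τ y Φ ω).card : ℝ)) μ := by
  refine (integrable_card_sq_roomPoints hPPP).1.mono' ?_ (Eventually.of_forall fun ω => ?_)
  · have := (Complex.measurable_re.comp (measurable_expSum_servingPoints (h := h) (β := β) (η := η)
      (σ := σ) (τ := τ) (y := y) hPPP 0))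
    refine this.aestronglyMeasurable.congr (Eventually.of_forall fun ω => ?_)
    simp [expSum_servingPoints_zero]
  · rw [Real.norm_of_nonneg (by positivity)]
    exact_mod_cast card_servingPoints_le a h β η σ τ y Φ ω

/-- On the imaginary axis the exponent has nonpositive real part, since Re(1 − exp(iu)) ≥ 0 for real
u. -/
theorem norm_transformK_le_one (hlam : 0 ≤ lam) (t : ℝ) :
    ‖transformK K lam a h β η (Complex.I * t) y‖ ≤ 1 := by
  rw [transformK, Complex.norm_exp, Real.exp_le_one_iff, neg_mul, Complex.neg_re,
    Complex.re_ofReal_mul, neg_nonpos]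
  refine mul_nonneg hlam ?_
  rw [Complex.re_sum]
  refine Finset.sum_nonneg fun k _ => ?_
  have hfinm : IsFiniteMeasure (volume.restrict (imageRegion k (-y) a)) := ⟨by
    rw [Measure.restrict_apply_univ]; exact (isCompact_imageRegion k (-y) a).measure_lt_top⟩
  have hexp : ∀ z : Plane, Complex.I * t * ((η ^ k / (‖z‖ ^ 2 + h ^ 2) ^ β : ℝ) : ℂ)
      = ((t * (η ^ k / (‖z‖ ^ 2 + h ^ 2) ^ β) : ℝ) : ℂ) * Complex.I := fun z => by
    push_cast; ring
  simp only [hexp]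
  have hi : Integrable (fun z : Plane => 1 - Complex.exp
      (((t * (η ^ k / (‖z‖ ^ 2 + h ^ 2) ^ β) : ℝ) : ℂ) * Complex.I))
      (volume.restrict (imageRegion k (-y) a)) := by
    refine (integrable_const (2 : ℝ)).mono' (Measurable.aestronglyMeasurable (by fun_prop))
      (Eventually.of_forall fun z => ?_)
    refine (norm_sub_le _ _).trans ?_
    rw [Complex.norm_exp_ofReal_mul_I, norm_one]; norm_num
  have hre := integral_re (𝕜 := ℂ) hi
  rw [RCLike.re_eq_complex_re] at hre
  rw [← hre]
  refine integral_nonneg fun z => ?_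
  rw [Pi.zero_apply, Complex.sub_re, Complex.one_re, sub_nonneg]
  exact (Complex.re_le_norm _).trans (Complex.norm_exp_ofReal_mul_I _).le

theorem integrable_sq_norm_transformF (hh : 0 < h) (hβ : 0 < β) (hη : 0 ≤ η) (hτ : 0 < τ) :
    Integrable fun t : ℝ => ((K + 1 : ℕ) : ℝ) * ∑ k ∈ Finset.range (K + 1),
      ‖∫ x in servingRegion a h β η σ τ k y, Complex.exp (-(Complex.I * t / τ) *
        ((η ^ k * (‖x‖ ^ 2 + h ^ 2) ^ (-β) : ℝ) : ℂ))‖ ^ 2 :=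
  (integrable_finsetSum _ fun k _ =>
    integrable_sq_norm_transformF_term hh hβ hη hτ k y).const_mul _

theorem sq_norm_transformF_le (s : ℂ) :
    ‖transformF K a h β η σ τ s y‖ ^ 2 ≤ ((K + 1 : ℕ) : ℝ) * ∑ k ∈ Finset.range (K + 1),
      ‖∫ x in servingRegion a h β η σ τ k y, Complex.exp (-s *
        ((η ^ k * (‖x‖ ^ 2 + h ^ 2) ^ (-β) : ℝ) : ℂ))‖ ^ 2 := by
  rw [transformF]
  refine (pow_le_pow_left₀ (norm_nonneg _) (norm_sum_le _ _) 2).trans ?_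
  refine sq_sum_le_card_mul_sum_sq.trans (le_of_eq ?_)
  rw [Finset.card_range]

theorem integrableOn_sq_norm_integral_expSum_servingPoints [IsFiniteMeasure μ] (hlam : 0 ≤ lam) (hh : 0 < h)
    (hβ : 0 < β) (hη : 0 ≤ η) (hτ : 0 < τ)
    (hPPP : ∀ k : Fin (K + 1), IsPoissonPointProcess (Φ k)
      (ENNReal.ofReal lam • (volume : Measure Plane).restrict (imageRegion (k : ℕ) 0 a)) μ)
    (hindep : iIndep (fun k => pointProcessSigma (Φ k)) μ) :
    IntegrableOn (fun t : ℝ => ‖∫ ω, expSum (servingPoints a h β η σ τ y Φ ω)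
      (sinrMargin a h β η σ τ y Φ ω) t ∂μ‖ ^ 2) (Set.Ioi 0) := by
  have hm := measurable_integral_expSum (μ := μ) (measurable_expSum_servingPoints (h := h)
    (β := β) (η := η) (σ := σ) (τ := τ) (y := y) hPPP)
  refine Integrable.integrableOn ?_
  refine ((integrable_sq_norm_transformF (K := K) (a := a) (σ := σ) (y := y) hh hβ hη
    hτ).const_mul (lam ^ 2)).mono' (hm.norm.pow_const 2).aestronglyMeasurable
    (Eventually.of_forall fun t => ?_)
  rw [norm_pow, norm_norm, integral_expSum_servingPoints hlam hh hβ hη hτ hPPP hindep, norm_mul,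
    Complex.norm_real, Real.norm_of_nonneg hlam, mul_pow]
  refine mul_le_mul_of_nonneg_left ?_ (sq_nonneg _)
  refine le_trans ?_ (sq_norm_transformF_le (Complex.I * t / τ))
  refine pow_le_pow_left₀ (norm_nonneg _) ?_ 2
  have h1 : Complex.I * t * (σ : ℂ) ^ 2 = ((t * σ ^ 2 : ℝ) : ℂ) * Complex.I := by push_cast; ring
  rw [norm_mul, norm_mul, h1, Complex.norm_exp_ofReal_mul_I, one_mul]
  exact mul_le_of_le_one_right (norm_nonneg _) (norm_transformK_le_one hlam t)

/-- This is the formula for φ at t = 0, where the exponential sum is a cardinality and K_M = 1. -/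
theorem integral_card_servingPoints [IsFiniteMeasure μ] (hlam : 0 ≤ lam) (ha : 0 < a) (hh : 0 < h) (hβ : 0 < β)
    (hη : 0 ≤ η) (hτ : 0 < τ)
    (hPPP : ∀ k : Fin (K + 1), IsPoissonPointProcess (Φ k)
      (ENNReal.ofReal lam • (volume : Measure Plane).restrict (imageRegion (k : ℕ) 0 a)) μ)
    (hindep : iIndep (fun k => pointProcessSigma (Φ k)) μ) :
    ∫ ω, ((servingPoints a h β η σ τ y Φ ω).card : ℝ) ∂μ
      = lam * volume.real (⋃ k ∈ Finset.range (K + 1), servingRegion a h β η σ τ k y) := by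
  have h1 := integral_expSum_servingPoints (σ := σ) (y := y) hlam hh hβ hη hτ hPPP hindep 0
  simp only [expSum_servingPoints_zero] at h1
  rw [volume_real_iUnion_servingRegion K ha]
  apply Complex.ofReal_injective
  rw [← integral_complex_ofReal]
  simp only [Complex.ofReal_natCast]
  rw [h1]
  simp [transformF, transformK]

end Intensity

end Coverage

/-! ### Coverage as the number of negative margins. -/

section CoverageProbability

open Filter

variable {Ω : Type*} {K : ℕ} {a h β η σ τ : ℝ} {Φ : Fin (K + 1) → Ω → Set Plane} {y : Plane} {ω : Ω}

theorem rxPower_add_rxPower_le_totalPower (hη : 0 ≤ η) {p q : Fin (K + 1) × Plane}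
    (hp : p ∈ roomPoints a Φ ω) (hq : q ∈ roomPoints a Φ ω) (hpq : p ≠ q) :
    rxPower h β η y p + rxPower h β η y q ≤ totalPower a h β η y Φ ω := by
  classical
  rw [← Finset.sum_pair hpq, totalPower]
  refine Finset.sum_le_sum_of_subset_of_nonneg ?_ fun _ _ _ => rxPower_nonneg hη y _
  intro r hr
  rcases Finset.mem_insert.mp hr with rfl | hr
  · exact hp
  · rwa [Finset.mem_singleton.mp hr]

theorem rxPower_le_totalPower (hη : 0 ≤ η) {p : Fin (K + 1) × Plane}
    (hp : p ∈ roomPoints a Φ ω) : rxPower h β η y p ≤ totalPower a h β η y Φ ω :=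
  Finset.single_le_sum (f := fun p => rxPower h β η y p) (fun _ _ => rxPower_nonneg hη y _) hp

/-- The total contains the powers of both p and q, so a negative margin of p leaves for q less than
(1/τ) times the power of p, which is at most the power of p. This is where τ ≥ 1 enters. -/
theorem rxPower_lt_of_sinrMargin_neg (hη : 0 ≤ η) (hτ : 1 ≤ τ)
    {p q : Fin (K + 1) × Plane} (hp : p ∈ roomPoints a Φ ω) (hq : q ∈ roomPoints a Φ ω)
    (hpq : p ≠ q) (hneg : sinrMargin a h β η σ τ y Φ ω p < 0) :
    rxPower h β η y q < rxPower h β η y p := by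
  have h1 := rxPower_add_rxPower_le_totalPower (h := h) (β := β) (y := y) hη hp hq hpq
  have h2 : 1 / τ * rxPower h β η y p ≤ rxPower h β η y p :=
    mul_le_of_le_one_left (rxPower_nonneg hη y p) (div_le_one_of_le₀ hτ (by linarith))
  rw [sinrMargin] at hneg
  nlinarith [sq_nonneg σ]

theorem mem_servingPoints_of_sinrMargin_neg (hh : 0 < h) (hβ : 0 < β) (hη : 0 ≤ η) (hσ : 0 < σ)
    (hτ : 0 < τ) (hfin : ∀ k : Fin (K + 1), (Φ k ω ∩ imageRegion k 0 a).Finite)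
    {p : Fin (K + 1) × Plane} (hp : p ∈ roomPoints a Φ ω)
    (hneg : sinrMargin a h β η σ τ y Φ ω p < 0) : p ∈ servingPoints a h β η σ τ y Φ ω := by
  classical
  rw [servingPoints, Finset.mem_filter]
  refine ⟨hp, mem_imageRegion_neg.mpr ?_, mem_ball_zero_iff.mpr ?_⟩
  · rw [sub_add_cancel]
    exact ((mem_roomPoints hfin).mp hp).2
  · refine lt_radiusD hh hβ hη hσ hτ (norm_nonneg _) ?_
    have h1 := rxPower_le_totalPower (h := h) (β := β) (y := y) hη hp
    rw [sinrMargin] at hneg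
    have h2 : σ ^ 2 < rxPower h β η y p / τ := by
      rw [← one_div_mul_eq_div]; linarith
    rw [lt_div_iff₀ hτ, mul_comm] at h2
    exact h2

/-- Two distinct points with negative margins would each be strictly stronger than the other; and no
negative margin is lost by passing to serving points. -/
theorem card_filter_sinrMargin_neg (hh : 0 < h) (hβ : 0 < β) (hη : 0 ≤ η) (hσ : 0 < σ)
    (hτ : 1 ≤ τ) (hfin : ∀ k : Fin (K + 1), (Φ k ω ∩ imageRegion k 0 a).Finite) :
    (((servingPoints a h β η σ τ y Φ ω).filter
        (fun p => sinrMargin a h β η σ τ y Φ ω p < 0)).card : ℝ)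
      = {ω | ∃ p ∈ roomPoints a Φ ω, sinrMargin a h β η σ τ y Φ ω p < 0}.indicator 1 ω := by
  classical
  have hsub : ∀ p ∈ servingPoints a h β η σ τ y Φ ω, p ∈ roomPoints a Φ ω := fun p hp =>
    (Finset.mem_filter.mp hp).1
  by_cases hex : ∃ p ∈ roomPoints a Φ ω, sinrMargin a h β η σ τ y Φ ω p < 0
  · have hmem : ω ∈ {ω | ∃ p ∈ roomPoints a Φ ω, sinrMargin a h β η σ τ y Φ ω p < 0} := hex
    rw [Set.indicator_of_mem hmem]
    obtain ⟨p, hp, hneg⟩ := hex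
    have hone : (servingPoints a h β η σ τ y Φ ω).filter
        (fun p => sinrMargin a h β η σ τ y Φ ω p < 0) = {p} := by
      refine Finset.eq_singleton_iff_unique_mem.mpr ⟨Finset.mem_filter.mpr
        ⟨mem_servingPoints_of_sinrMargin_neg hh hβ hη hσ (by linarith) hfin hp hneg, hneg⟩,
        fun q hq => ?_⟩
      obtain ⟨hq1, hq2⟩ := Finset.mem_filter.mp hq
      by_contra hne
      exact lt_asymm (rxPower_lt_of_sinrMargin_neg hη hτ (hsub q hq1) hp hne hq2)
        (rxPower_lt_of_sinrMargin_neg hη hτ hp (hsub q hq1) (Ne.symm hne) hneg)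
    rw [hone]
    simp
  · have hmem : ω ∉ {ω | ∃ p ∈ roomPoints a Φ ω, sinrMargin a h β η σ τ y Φ ω p < 0} := hex
    rw [Set.indicator_of_notMem hmem]
    have : (servingPoints a h β η σ τ y Φ ω).filter
        (fun p => sinrMargin a h β η σ τ y Φ ω p < 0) = ∅ :=
      Finset.filter_eq_empty_iff.mpr fun p hp hneg => hex ⟨p, hsub p hp, hneg⟩
    rw [this]
    simp

theorem lt_sinr_iff (hη : 0 ≤ η) (hσ : 0 < σ) (hτ : 0 < τ)
    (hT : transmitters Φ ω = roomPoints a Φ ω) {p : Fin (K + 1) × Plane}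
    (hp : p ∈ roomPoints a Φ ω) :
    τ < sinr h β η σ y (transmitters Φ ω) p ↔ sinrMargin a h β η σ τ y Φ ω p < 0 := by
  classical
  have hI : interference h β η y (transmitters Φ ω) p
      = totalPower a h β η y Φ ω - rxPower h β η y p := by
    have hset : transmitters Φ ω \ {p} = ((roomPoints a Φ ω).erase p : Set _) := by
      rw [hT, Finset.coe_erase]
    rw [interference, hset, Finset.tsum_subtype' _ (rxPower h β η y), totalPower,
      ← Finset.add_sum_erase _ _ hp, add_sub_cancel_left]
  have h1 := rxPower_le_totalPower (h := h) (β := β) (y := y) hη hp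
  have hden : 0 < totalPower a h β η y Φ ω - rxPower h β η y p + σ ^ 2 := by
    have := pow_pos hσ 2
    linarith
  rw [sinr, hI, lt_div_iff₀ hden, mul_comm, ← lt_div_iff₀ hτ, sinrMargin, ← one_div_mul_eq_div]
  constructor <;> intro <;> linarith

theorem mem_coverageEvent_iff (hη : 0 ≤ η) (hσ : 0 < σ) (hτ : 1 ≤ τ)
    (hfin : ∀ k : Fin (K + 1), (Φ k ω ∩ imageRegion k 0 a).Finite)
    (hsub : ∀ k : Fin (K + 1), Φ k ω ⊆ imageRegion k 0 a) :
    ω ∈ coverageEvent h β η σ τ Φ y ↔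
      ∃ p ∈ roomPoints a Φ ω, sinrMargin a h β η σ τ y Φ ω p < 0 := by
  have hT : transmitters Φ ω = roomPoints a Φ ω := by
    ext p
    rw [Finset.mem_coe, mem_roomPoints hfin, iff_self_and]
    exact fun hp => hsub p.1 hp
  have hτ0 : 0 < τ := by linarith
  have hmem : ∀ p, p ∈ transmitters Φ ω ↔ p ∈ roomPoints a Φ ω := fun p => by
    rw [hT, Finset.mem_coe]
  constructor
  · rintro ⟨p, hp, -, hlt⟩
    exact ⟨p, (hmem p).mp hp, (lt_sinr_iff hη hσ hτ0 hT ((hmem p).mp hp)).mp hlt⟩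
  · rintro ⟨p, hp, hneg⟩
    refine ⟨p, (hmem p).mpr hp, fun q hq => ?_, (lt_sinr_iff hη hσ hτ0 hT hp).mpr hneg⟩
    rcases eq_or_ne p q with rfl | hpq
    · exact le_rfl
    · exact (rxPower_lt_of_sinrMargin_neg hη hτ hp ((hmem q).mp hq) hpq hneg).le

variable [MeasurableSpace Ω] {μ : Measure Ω} {lam : ℝ}

/-- The threshold for a point's power is itself random. A rational q strictly between the two sides
of the inequality decouples them: the total power is compared with q, and the points are counted in
a fixed set `V q`. -/
theorem measurableSet_exists_sinrMargin_neg
    (hPPP : ∀ k : Fin (K + 1), IsPoissonPointProcess (Φ k)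
      (ENNReal.ofReal lam • (volume : Measure Plane).restrict (imageRegion (k : ℕ) 0 a)) μ) :
    MeasurableSet {ω | ∃ p ∈ roomPoints a Φ ω, sinrMargin a h β η σ τ y Φ ω p < 0} := by
  have hsum : ∀ u : Fin (K + 1) × Plane → ℝ, (∀ k, Measurable fun x => u (k, x)) →
      Measurable fun ω => ∑ p ∈ roomPoints a Φ ω, u p := by
    intro u hu
    simp only [sum_roomPoints]
    exact Finset.measurable_fun_sum _ fun k _ =>
      (measurable_sum_pointsIn (measurableSet_imageRegion k 0 a) (finite_inter_imageRegion hPPP k)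
        (hu k).stronglyMeasurable).mono (pointProcessSigma_le (hPPP k)) le_rfl
  have hI : Measurable (totalPower a h β η y Φ) := hsum _ fun k => measurable_rxPower h β η y k
  set V : ℚ → Set (Fin (K + 1) × Plane) :=
    fun q => {p | (q : ℝ) < (1 + 1 / τ) * rxPower h β η y p} with hV
  have hcount : ∀ q, MeasurableSet {ω | ∃ p ∈ roomPoints a Φ ω, p ∈ V q} := by
    intro q
    have hm := hsum ((V q).indicator 1) fun k => by
      have hS : MeasurableSet (Prod.mk k ⁻¹' V q) :=
        measurableSet_lt measurable_const ((measurable_rxPower h β η y k).const_mul _)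
      have : (fun x => (V q).indicator (1 : Fin (K + 1) × Plane → ℝ) (k, x))
          = (Prod.mk k ⁻¹' V q).indicator 1 := by
        ext x
        by_cases hx : (k, x) ∈ V q
        · have hx' : x ∈ Prod.mk k ⁻¹' V q := hx
          rw [Set.indicator_of_mem hx, Set.indicator_of_mem hx']
          rfl
        · have hx' : x ∉ Prod.mk k ⁻¹' V q := hx
          rw [Set.indicator_of_notMem hx, Set.indicator_of_notMem hx']
      rw [this]
      exact measurable_one.indicator hS
    have heq : {ω | ∃ p ∈ roomPoints a Φ ω, p ∈ V q}
        = {ω | 0 < ∑ p ∈ roomPoints a Φ ω, (V q).indicator (1 : Fin (K + 1) × Plane → ℝ) p} := by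
      ext ω
      have hnn : ∀ p ∈ roomPoints a Φ ω,
          0 ≤ (V q).indicator (1 : Fin (K + 1) × Plane → ℝ) p := fun p _ =>
        Set.indicator_nonneg (fun _ _ => zero_le_one) p
      rw [Set.mem_ofPred_eq, Set.mem_ofPred_eq, Finset.sum_pos_iff_of_nonneg hnn]
      refine exists_congr fun p => and_congr_right fun _ => ?_
      by_cases hp : p ∈ V q <;> simp [hp]
    rw [heq]
    exact measurableSet_lt measurable_const hm
  have hset : {ω | ∃ p ∈ roomPoints a Φ ω, sinrMargin a h β η σ τ y Φ ω p < 0}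
      = ⋃ q : ℚ, {ω | totalPower a h β η y Φ ω + σ ^ 2 < q} ∩
        {ω | ∃ p ∈ roomPoints a Φ ω, p ∈ V q} := by
    ext ω
    simp only [Set.mem_ofPred_eq, Set.mem_iUnion, Set.mem_inter_iff, hV, sinrMargin, sub_neg]
    constructor
    · rintro ⟨p, hp, hlt⟩
      obtain ⟨q, hq1, hq2⟩ := exists_rat_btwn hlt
      exact ⟨q, hq1, p, hp, hq2⟩
    · rintro ⟨q, hq1, p, hp, hq2⟩
      exact ⟨p, hp, hq1.trans hq2⟩
  rw [hset]
  exact MeasurableSet.iUnion fun q =>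
    (measurableSet_lt (hI.add_const _) measurable_const).inter (hcount q)

end CoverageProbability

theorem theorem2 {Ω : Type*} [MeasurableSpace Ω] (μ : Measure Ω) [IsProbabilityMeasure μ]
    (K : ℕ) (lam a h β η σ τ : ℝ) (hlam : 0 < lam) (ha : 0 < a) (hh : 0 < h) (hβ : 0 < β)
    (hη : 0 ≤ η) (hσ : 0 < σ) (hτ : 1 ≤ τ)
    (Φ : Fin (K + 1) → Ω → Set Plane)
    (hPPP : ∀ k : Fin (K + 1), IsPoissonPointProcess (Φ k)
      (ENNReal.ofReal lam • (volume : Measure Plane).restrict (imageRegion (k : ℕ) 0 a)) μ)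
    (hindep : iIndep (fun k => pointProcessSigma (Φ k)) μ)
    (y : Plane) :
    NullMeasurableSet (coverageEvent h β η σ τ Φ y) μ ∧
    IntegrableOn (inversionIntegrand K lam a h β η σ τ y) (Set.Ioi 0) ∧
    μ.real (coverageEvent h β η σ τ Φ y) =
      lam * volume.real (⋃ k ∈ Finset.range (K + 1), servingRegion a h β η σ τ k y) / 2
        - lam / Real.pi * ∫ t in Set.Ioi (0 : ℝ), inversionIntegrand K lam a h β η σ τ y t := by
  have hτ0 : 0 < τ := by linarith
  have hfin := finite_inter_imageRegion hPPP
  set A : Set Ω := {ω | ∃ p ∈ roomPoints a Φ ω, sinrMargin a h β η σ τ y Φ ω p < 0} with hA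
  have hAm : MeasurableSet A := measurableSet_exists_sinrMargin_neg hPPP
  have hsub : ∀ᵐ ω ∂μ, ∀ k : Fin (K + 1), Φ k ω ⊆ imageRegion k 0 a := by
    refine ae_subset_of_compl_null hPPP (fun k => measurableSet_imageRegion k 0 a) fun k => ?_
    rw [Measure.smul_apply, Measure.restrict_apply (measurableSet_imageRegion k 0 a).compl,
      Set.compl_inter_self, measure_empty, smul_zero]
  -- Points outside the regions, possible on a null set, could alter coverage there; this is why the
  -- event is only shown to be null measurable.
  have hae : coverageEvent h β η σ τ Φ y =ᵐ[μ] A := by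
    filter_upwards [hsub] with ω hω
    exact propext (mem_coverageEvent_iff hη hσ hτ (fun k => hfin k ω) hω)
  obtain ⟨W, hW, hX⟩ := exists_integrable_bound_sinrMargin (σ := σ) (y := y) hh hβ hη hτ0 hPPP
  have hmeas := measurable_expSum_servingPoints (h := h) (β := β) (η := η) (σ := σ) (τ := τ)
    (y := y) hPPP
  have hcard := integrable_card_servingPoints (h := h) (β := β) (η := η) (σ := σ) (τ := τ)
    (y := y) hPPP
  have hL2 := integrableOn_sq_norm_integral_expSum_servingPoints (σ := σ) (y := y) hlam.le hh hβ
    hη hτ0 hPPP hindep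
  have hint := integrableOn_inv_mul_im_integral_expSum hmeas hcard hW hX hL2
  have hinv := integral_card_filter_neg hmeas hcard hW hX hL2
  have hφ : ∀ t : ℝ, 1 / t * (∫ ω, expSum (servingPoints a h β η σ τ y Φ ω)
      (sinrMargin a h β η σ τ y Φ ω) t ∂μ).im
      = lam * inversionIntegrand K lam a h β η σ τ y t := by
    intro t
    rw [integral_expSum_servingPoints hlam.le hh hβ hη hτ0 hPPP hindep, Complex.im_ofReal_mul,
      inversionIntegrand]
    ring
  simp only [hφ] at hint hinv
  refine ⟨hAm.nullMeasurableSet.congr hae.symm, ?_, ?_⟩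
  · refine (hint.const_mul lam⁻¹).congr (Filter.Eventually.of_forall fun t => ?_)
    simp only [inv_mul_cancel_left₀ hlam.ne']
  · rw [measureReal_congr hae, ← integral_indicator_one hAm]
    -- The mean count in the inversion formula becomes the mean of an indicator, that is, the
    -- probability of `A`.
    simp only [card_filter_sinrMargin_neg hh hβ hη hσ hτ (fun k => hfin k _)] at hinv
    rw [hinv, integral_card_servingPoints hlam.le ha hh hβ hη hτ0 hPPP hindep, integral_const_mul]
    ring
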